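/- Let $\Gamma$ be a divisible (totally) ordered abelian group, let $\mathbb{T}_{\max}=(\Gamma\cup\{\bot\},\max,+)$ be the tropical semifield over $\Gamma$, with zero $\mathbb{0}=\bot$, and let $\mathbb{S}_{\max}$ be the symmetrized tropical semiring over $\Gamma$, that is the quotient of the semiring $\mathbb{T}_{\max}^2$ of pairs, with $$(a_1,a_2)\oplus(b_1,b_2)=(a_1\oplus b_1,a_2\oplus b_2),\qquad (a_1,a_2)\odot(b_1,b_2)=(a_1b_1\oplus a_2b_2,\ a_1b_2\oplus a_2b_1),$$ by the congruence that identifies $(a_1,a_2)$ and $(b_1,b_2)$ if they are equal, or if $a_1\ne a_2$, $b_1\ne b_2$ and $a_1\oplus b_2=a_2\oplus b_1$. Write $\ominus$ for the operation induced by $(a_1,a_2)\mapsto(a_2,a_1)$, $|\cdot|:\mathbb{S}_{\max}\to\mathbb{T}_{\max}$ for the map induced by $(a_1,a_2)\mapsto a_1\oplus a_2$, and identify $c\in\mathbb{T}_{\max}$ with the class of $(c,\bot)$. An element is signed if it is $c$ or $\ominus c$ for some $c\in\mathbb{T}_{\max}$; the set of signed elements is $\mathbb{S}_{\max}^\vee$.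 Write $a\,\nabla\,b$ if $a\ominus b$ is the class of a pair $(c,c)$; for polynomials $\nabla$ is meant coefficientwise. Let $P=\bigoplus_{k=m}^{n}P_k\mathsf{Y}^k$ be a nonzero formal polynomial with coefficients in $\mathbb{S}_{\max}^\vee$, of degree $n$ and lower degree $m$. Its polynomial function is $\widehat P:\mathbb{S}_{\max}\to\mathbb{S}_{\max}$, and a root of $P$ is an element $r\in\mathbb{S}_{\max}^\vee$ with $\widehat P(r)\,\nabla\,\mathbb{0}$. The multiplicity $\mathrm{mult}_r(P)$ is defined recursively: it is $0$ if $r$ is not a root of $P$, and otherwise it is $1+\max \mathrm{mult}_r(Q)$, over all formal polynomials $Q$ with coefficients in $\mathbb{S}_{\max}^\vee$ such that $\lambda P\,\nabla\,(\mathsf{Y}\ominus r)Q$ for some $\lambda\in\mathbb{S}_{\max}^\vee\setminus\{\mathbb{0}\}$. A factorization of $\widehat P$ is a multiset $\{s_1,\dots,s_n\}$ of elements of $\mathbb{S}_{\max}^\vee$ such that $\widehat P(y)=P_n\odot(y\ominus s_1)\odot\cdots\odot(y\ominus s_n)$ for all $y\in\mathbb{S}_{\max}$. Let $|P|=\bigoplus_k|P_k|\mathsf{Y}^k$.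 A nonzero corner of $|P|$ is a $c\in\mathbb{T}_{\max}\setminus\{\mathbb{0}\}$ at which the maximum $\bigoplus_k|P_k|c^k$ is attained by at least two different monomials of $|P|$. Assume that $|P|$ is factored, that is $|P|=|P_n|(\mathsf{Y}\oplus c_1)\cdots(\mathsf{Y}\oplus c_n)$ as formal polynomials, for some $c_1,\dots,c_n\in\mathbb{T}_{\max}$. Then there are unique $r_1,\dots,r_n\in\mathbb{S}_{\max}^\vee$ such that $r_i\odot P_{n-i+1}=\ominus P_{n-i}$ for $i\le n-m$ and $r_i=\mathbb{0}$ for $n-m<i\le n$, and the following two conditions are equivalent: (a) all the $r_i$ with the same modulus $|r_i|$ are equal; (b) for each corner $c\neq\mathbb{0}$ of $|P|$, $c$ and $\ominus c$ are not both roots of $P$. If they hold, then $r_1,\dots,r_n$ is a factorization of $\widehat P$, it is the only one (up to reordering) when $\Gamma$ is non-trivial, and for every root $r$ of $P$ the multiplicity $\mathrm{mult}_r(P)$ is the number of occurrences of $r$ in this factorization, that is the number of indices $i$ with $r_i=r$. -/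

import Mathlib

open Polynomial

set_option linter.unusedSectionVars false

/-! ### The tropical semifield over an ordered abelian group -/

/-- The tropical semifield `(Γ ∪ {⊥}, max, +)`. Its order is that of `WithBot Γ`; below, semiring
notation is used, so that `0` is `⊥`, `1` is the zero of `Γ`, `a + b` is `max a b`, and `a * b` is
the sum of `a` and `b` in `Γ ∪ {⊥}`. -/
def Tmax (Γ : Type*) : Type _ := WithBot Γ

namespace Tmax

variable {Γ : Type*} [AddCommGroup Γ] [LinearOrder Γ] [IsOrderedAddMonoid Γ]

instance : LinearOrder (Tmax Γ) := inferInstanceAs (LinearOrder (WithBot Γ))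

instance : Zero (Tmax Γ) := ⟨(⊥ : WithBot Γ)⟩
instance : One (Tmax Γ) := ⟨((0 : Γ) : WithBot Γ)⟩
instance : Add (Tmax Γ) := ⟨fun a b => max a b⟩
instance : Mul (Tmax Γ) :=
  ⟨fun a b => ((show WithBot Γ from a) + (show WithBot Γ from b) : WithBot Γ)⟩

instance : CommSemiring (Tmax Γ) where
  add_assoc a b c := max_assoc (α := WithBot Γ) a b c
  add_comm a b := max_comm (α := WithBot Γ) a b
  zero_add a := bot_sup_eq (α := WithBot Γ) a
  add_zero a := sup_bot_eq (α := WithBot Γ) a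
  mul_assoc a b c := add_assoc (G := WithBot Γ) a b c
  mul_comm a b := add_comm (G := WithBot Γ) a b
  one_mul a := zero_add (M := WithBot Γ) a
  mul_one a := add_zero (M := WithBot Γ) a
  zero_mul a := WithBot.bot_add (α := Γ) a
  mul_zero a := WithBot.add_bot (α := Γ) a
  left_distrib a b c := (max_add_add_left (α := WithBot Γ) a b c).symm
  right_distrib a b c := (max_add_add_right (α := WithBot Γ) a b c).symm
  nsmul := nsmulRec
  npow := npowRec

theorem add_def (a b : Tmax Γ) : a + b = max a b := rfl

theorem zero_le (a : Tmax Γ) : 0 ≤ a := bot_le (α := WithBot Γ) (a := a)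

theorem mul_lt_mul_right' {a b c : Tmax Γ} (h : a < b) (hc : 0 < c) : a * c < b * c := by
  change WithBot Γ at a b c
  have hc' : c ≠ ⊥ := ne_of_gt (show (⊥ : WithBot Γ) < c from hc)
  exact WithBot.add_lt_add_right hc' h

theorem mul_lt_mul_left' {a b c : Tmax Γ} (h : a < b) (hc : 0 < c) : c * a < c * b := by
  rw [mul_comm c a, mul_comm c b]; exact mul_lt_mul_right' h hc

theorem mul_le_mul_right' {a b : Tmax Γ} (h : a ≤ b) (c : Tmax Γ) : a * c ≤ b * c := by
  rcases h.eq_or_lt with rfl | h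
  · exact le_rfl
  · rcases (zero_le c).eq_or_lt with rfl | hc
    · simp
    · exact (mul_lt_mul_right' h hc).le

end Tmax

/-! ### Pairs of tropical numbers -/

/-- Pairs of tropical numbers, with the operations
`(a₁, a₂) + (b₁, b₂) = (a₁ + b₁, a₂ + b₂)` and
`(a₁, a₂) * (b₁, b₂) = (a₁ b₁ + a₂ b₂, a₁ b₂ + a₂ b₁)`. -/
@[ext]
structure TmaxPair (Γ : Type*) where
  fst : Tmax Γ
  snd : Tmax Γ

namespace TmaxPair

variable {Γ : Type*} [AddCommGroup Γ] [LinearOrder Γ] [IsOrderedAddMonoid Γ]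

instance : Zero (TmaxPair Γ) := ⟨⟨0, 0⟩⟩
instance : One (TmaxPair Γ) := ⟨⟨1, 0⟩⟩
instance : Add (TmaxPair Γ) := ⟨fun a b => ⟨a.fst + b.fst, a.snd + b.snd⟩⟩
instance : Mul (TmaxPair Γ) :=
  ⟨fun a b => ⟨a.fst * b.fst + a.snd * b.snd, a.fst * b.snd + a.snd * b.fst⟩⟩
/-- The minus operator `(a₁, a₂) ↦ (a₂, a₁)`. -/
instance : Neg (TmaxPair Γ) := ⟨fun a => ⟨a.snd, a.fst⟩⟩

@[simp] theorem zero_fst : (0 : TmaxPair Γ).fst = 0 := rfl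
@[simp] theorem zero_snd : (0 : TmaxPair Γ).snd = 0 := rfl
@[simp] theorem one_fst : (1 : TmaxPair Γ).fst = 1 := rfl
@[simp] theorem one_snd : (1 : TmaxPair Γ).snd = 0 := rfl
@[simp] theorem add_fst (a b : TmaxPair Γ) : (a + b).fst = a.fst + b.fst := rfl
@[simp] theorem add_snd (a b : TmaxPair Γ) : (a + b).snd = a.snd + b.snd := rfl
@[simp] theorem mul_fst (a b : TmaxPair Γ) :
    (a * b).fst = a.fst * b.fst + a.snd * b.snd := rfl
@[simp] theorem mul_snd (a b : TmaxPair Γ) :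
    (a * b).snd = a.fst * b.snd + a.snd * b.fst := rfl
@[simp] theorem neg_fst (a : TmaxPair Γ) : (-a).fst = a.snd := rfl
@[simp] theorem neg_snd (a : TmaxPair Γ) : (-a).snd = a.fst := rfl

instance : CommSemiring (TmaxPair Γ) where
  add_assoc a b c := by ext <;> simp [add_assoc]
  add_comm a b := by ext <;> simp [add_comm]
  zero_add a := by ext <;> simp
  add_zero a := by ext <;> simp
  mul_assoc a b c := by ext <;> simp <;> ring
  mul_comm a b := by ext <;> simp <;> ring
  one_mul a := by ext <;> simp
  mul_one a := by ext <;> simp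
  zero_mul a := by ext <;> simp
  mul_zero a := by ext <;> simp
  left_distrib a b c := by ext <;> simp <;> ring
  right_distrib a b c := by ext <;> simp <;> ring
  nsmul := nsmulRec
  npow := npowRec

/-- The relation by which pairs are identified: `a₁ + b₂ = a₂ + b₁` if `a₁ ≠ a₂` and `b₁ ≠ b₂`,
and `a = b` otherwise. -/
def Rel (a b : TmaxPair Γ) : Prop :=
  (a.fst ≠ a.snd ∧ b.fst ≠ b.snd ∧ a.fst + b.snd = a.snd + b.fst) ∨
    (¬ (a.fst ≠ a.snd ∧ b.fst ≠ b.snd) ∧ a = b)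

theorem rel_iff (a b : TmaxPair Γ) :
    Rel a b ↔ a = b ∨ (a.snd < a.fst ∧ b.snd < b.fst ∧ a.fst = b.fst) ∨
      (a.fst < a.snd ∧ b.fst < b.snd ∧ a.snd = b.snd) := by
  obtain ⟨a₁, a₂⟩ := a
  obtain ⟨b₁, b₂⟩ := b
  simp only [Rel, Tmax.add_def, TmaxPair.mk.injEq]
  constructor
  · rintro (⟨ha, hb, h⟩ | ⟨-, h⟩)
    · rcases lt_or_gt_of_ne ha with ha | ha <;> rcases lt_or_gt_of_ne hb with hb | hb <;> grind
    · exact Or.inl h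
  · rintro (⟨rfl, rfl⟩ | ⟨ha, hb, rfl⟩ | ⟨ha, hb, rfl⟩)
    · by_cases h : a₁ = a₂
      · exact Or.inr ⟨fun h' => h'.1 h, rfl, rfl⟩
      · exact Or.inl ⟨h, h, max_comm _ _⟩
    · exact Or.inl ⟨ha.ne', hb.ne', by rw [max_eq_left hb.le, max_eq_right ha.le]⟩
    · exact Or.inl ⟨ha.ne, hb.ne, by rw [max_eq_right ha.le, max_eq_left hb.le]⟩

theorem Rel.refl (a : TmaxPair Γ) : Rel a a := (rel_iff a a).2 (Or.inl rfl)

theorem Rel.symm {a b : TmaxPair Γ} (h : Rel a b) : Rel b a := by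
  rw [rel_iff] at h ⊢
  grind

theorem Rel.trans {a b c : TmaxPair Γ} (h : Rel a b) (h' : Rel b c) : Rel a c := by
  rw [rel_iff] at h h' ⊢
  grind

theorem Rel.neg {a b : TmaxPair Γ} (h : Rel a b) : Rel (-a) (-b) := by
  rw [rel_iff] at h ⊢
  rcases h with rfl | h | h
  · exact Or.inl rfl
  · exact Or.inr (Or.inr h)
  · exact Or.inr (Or.inl h)

theorem neg_neg' (a : TmaxPair Γ) : - -a = a := rfl

theorem neg_add' (a b : TmaxPair Γ) : -(a + b) = -a + -b := rfl

theorem neg_mul' (a b : TmaxPair Γ) : -a * b = -(a * b) := by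
  ext <;> simp [add_comm]

theorem Rel.add_right {a b : TmaxPair Γ} (h : Rel a b) (c : TmaxPair Γ) :
    Rel (a + c) (b + c) := by
  rw [rel_iff] at h ⊢
  obtain ⟨a₁, a₂⟩ := a
  obtain ⟨b₁, b₂⟩ := b
  obtain ⟨c₁, c₂⟩ := c
  simp only [add_fst, add_snd, Tmax.add_def, TmaxPair.ext_iff] at h ⊢
  grind

theorem Rel.mul_right_aux {a b : TmaxPair Γ} (ha : a.snd < a.fst) (hb : b.snd < b.fst)
    (hab : a.fst = b.fst) (c : TmaxPair Γ) : Rel (a * c) (b * c) := by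
  have key : ∀ x : TmaxPair Γ, x.snd < x.fst →
      (c.snd < c.fst → (x * c).snd < (x * c).fst ∧ (x * c).fst = x.fst * c.fst) ∧
      (c.fst < c.snd → (x * c).fst < (x * c).snd ∧ (x * c).snd = x.fst * c.snd) ∧
      (c.fst = c.snd → x * c = ⟨x.fst * c.fst, x.fst * c.fst⟩) := by
    intro x hx
    have hx0 : 0 < x.fst := lt_of_le_of_lt (Tmax.zero_le _) hx
    refine ⟨fun hc => ?_, fun hc => ?_, fun hc => ?_⟩
    · have hc0 : 0 < c.fst := lt_of_le_of_lt (Tmax.zero_le _) hc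
      have h1 : x.fst * c.snd < x.fst * c.fst := Tmax.mul_lt_mul_left' hc hx0
      have h2 : x.snd * c.fst < x.fst * c.fst := Tmax.mul_lt_mul_right' hx hc0
      have h3 : x.snd * c.snd ≤ x.fst * c.snd := Tmax.mul_le_mul_right' hx.le _
      simp only [mul_fst, mul_snd, Tmax.add_def]
      rw [max_eq_left (h3.trans h1.le)]
      exact ⟨max_lt h1 h2, rfl⟩
    · have hc0 : 0 < c.snd := lt_of_le_of_lt (Tmax.zero_le _) hc
      have h1 : x.fst * c.fst < x.fst * c.snd := Tmax.mul_lt_mul_left' hc hx0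
      have h2 : x.snd * c.snd < x.fst * c.snd := Tmax.mul_lt_mul_right' hx hc0
      have h3 : x.snd * c.fst ≤ x.fst * c.fst := Tmax.mul_le_mul_right' hx.le _
      simp only [mul_fst, mul_snd, Tmax.add_def]
      rw [max_eq_left (h3.trans h1.le)]
      exact ⟨max_lt h1 h2, rfl⟩
    · have h3 : x.snd * c.snd ≤ x.fst * c.snd := Tmax.mul_le_mul_right' hx.le _
      ext
      · simp only [mul_fst, Tmax.add_def, hc]
        exact max_eq_left h3
      · simp only [mul_snd, Tmax.add_def, hc]
        exact max_eq_left h3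
  rw [rel_iff]
  obtain ⟨a1, a2, a3⟩ := key a ha
  obtain ⟨b1, b2, b3⟩ := key b hb
  rcases lt_trichotomy c.fst c.snd with hc | hc | hc
  · exact Or.inr (Or.inr ⟨(a2 hc).1, (b2 hc).1, by rw [(a2 hc).2, (b2 hc).2, hab]⟩)
  · exact Or.inl (by rw [a3 hc, b3 hc, hab])
  · exact Or.inr (Or.inl ⟨(a1 hc).1, (b1 hc).1, by rw [(a1 hc).2, (b1 hc).2, hab]⟩)

theorem Rel.mul_right {a b : TmaxPair Γ} (h : Rel a b) (c : TmaxPair Γ) :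
    Rel (a * c) (b * c) := by
  rcases (rel_iff a b).1 h with rfl | ⟨ha, hb, hab⟩ | ⟨ha, hb, hab⟩
  · exact Rel.refl _
  · exact Rel.mul_right_aux ha hb hab c
  · have := (Rel.mul_right_aux (a := -a) (b := -b) ha hb hab c).neg
    rwa [neg_mul', neg_mul', neg_neg', neg_neg'] at this

/-- `Rel` as a congruence of the semiring of pairs. -/
def con (Γ : Type*) [AddCommGroup Γ] [LinearOrder Γ] [IsOrderedAddMonoid Γ] :
    RingCon (TmaxPair Γ) where
  r := Rel
  iseqv := ⟨Rel.refl, Rel.symm, Rel.trans⟩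
  add' {a b c d} h h' := by
    refine (h.add_right c).trans ?_
    rw [add_comm b c, add_comm b d]
    exact h'.add_right b
  mul' {a b c d} h h' := by
    refine (h.mul_right c).trans ?_
    rw [mul_comm b c, mul_comm b d]
    exact h'.mul_right b

/-- The absolute value `|(a₁, a₂)| = a₁ + a₂` of pairs, as a morphism of semirings. -/
def abs (Γ : Type*) [AddCommGroup Γ] [LinearOrder Γ] [IsOrderedAddMonoid Γ] :
    TmaxPair Γ →+* Tmax Γ where
  toFun a := a.fst + a.snd
  map_zero' := by simp
  map_one' := by simp
  map_add' a b := by simp only [add_fst, add_snd]; ring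
  map_mul' a b := by simp only [mul_fst, mul_snd]; ring

theorem abs_eq_of_rel {a b : TmaxPair Γ} (h : Rel a b) : abs Γ a = abs Γ b := by
  change a.fst + a.snd = b.fst + b.snd
  rcases (rel_iff a b).1 h with rfl | ⟨ha, hb, hab⟩ | ⟨ha, hb, hab⟩
  · rfl
  · rw [Tmax.add_def, Tmax.add_def, max_eq_left ha.le, max_eq_left hb.le, hab]
  · rw [Tmax.add_def, Tmax.add_def, max_eq_right ha.le, max_eq_right hb.le, hab]

end TmaxPair

/-! ### The symmetrized tropical semiring -/

/-- The symmetrized tropical semiring: the quotient of the semiring of pairs of tropical numbers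
by the congruence `TmaxPair.Rel`. -/
def Smax (Γ : Type*) [AddCommGroup Γ] [LinearOrder Γ] [IsOrderedAddMonoid Γ] : Type _ :=
  (TmaxPair.con Γ).Quotient

namespace Smax

variable {Γ : Type*} [AddCommGroup Γ] [LinearOrder Γ] [IsOrderedAddMonoid Γ]

instance : CommSemiring (Smax Γ) := inferInstanceAs (CommSemiring (TmaxPair.con Γ).Quotient)

/-- The class of a pair, as a morphism of semirings. -/
def mk : TmaxPair Γ →+* Smax Γ := (TmaxPair.con Γ).mk'

theorem mk_surjective : Function.Surjective (mk : TmaxPair Γ → Smax Γ) :=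
  (TmaxPair.con Γ).mk'_surjective

theorem mk_eq_mk {a b : TmaxPair Γ} : mk a = mk b ↔ TmaxPair.Rel a b :=
  (TmaxPair.con Γ).eq

/-- The minus operator `⊖`, induced by `(a₁, a₂) ↦ (a₂, a₁)`. The element `a ⊖ b` is written
`a + -b` below. -/
instance : Neg (Smax Γ) :=
  ⟨Quotient.map (sa := (TmaxPair.con Γ).toSetoid) (sb := (TmaxPair.con Γ).toSetoid)
    (fun a => -a) (fun _ _ h => TmaxPair.Rel.neg h)⟩

theorem neg_mk (a : TmaxPair Γ) : -(mk a) = mk (-a) := rfl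

/-- The absolute value, induced by `(a₁, a₂) ↦ a₁ + a₂`, as a morphism of semirings. -/
def abs (Γ : Type*) [AddCommGroup Γ] [LinearOrder Γ] [IsOrderedAddMonoid Γ] :
    Smax Γ →+* Tmax Γ :=
  (TmaxPair.con Γ).lift (TmaxPair.abs Γ) (fun _ _ h => TmaxPair.abs_eq_of_rel h)

theorem abs_mk (a : TmaxPair Γ) : abs Γ (mk a) = a.fst + a.snd := rfl

/-- The embedding `c ↦ (c, ⊥)` of the tropical semifield as the set of positive or zero
elements. -/
def pos (c : Tmax Γ) : Smax Γ := mk ⟨c, 0⟩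

/-- Signed elements: positive, negative or zero. -/
def IsSigned (x : Smax Γ) : Prop := ∃ c : Tmax Γ, x = pos c ∨ x = -pos c

/-- Tangible elements: the nonzero signed elements. -/
def IsTangible (x : Smax Γ) : Prop := IsSigned x ∧ x ≠ 0

/-- Balance elements: the classes of the pairs `(c, c)`. -/
def IsBalanced (x : Smax Γ) : Prop := ∃ c : Tmax Γ, x = mk ⟨c, c⟩

/-- The surpassing relation `a ≼° b`: `b = a + c` for some balance element `c`. -/
def Surpass (a b : Smax Γ) : Prop := ∃ c : Smax Γ, IsBalanced c ∧ b = a + c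

/-- The balance relation `a ∇ b`, that is `0 ≼° a ⊖ b`. -/
def Balances (a b : Smax Γ) : Prop := Surpass 0 (a + -b)

/-- On pairs, `a ∇ b` means `a₁ + b₂ = a₂ + b₁`. -/
theorem balances_mk (a b : TmaxPair Γ) :
    Balances (mk a) (mk b) ↔ a.fst + b.snd = a.snd + b.fst := by
  have h : Balances (mk a) (mk b) ↔ ∃ c : Tmax Γ, mk (a + -b) = mk ⟨c, c⟩ := by
    simp [Balances, Surpass, IsBalanced, neg_mk, map_add]
  rw [h]
  constructor
  · rintro ⟨c, hc⟩
    rw [mk_eq_mk, TmaxPair.rel_iff] at hc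
    rcases hc with hc | hc | hc
    · have h1 := congrArg TmaxPair.fst hc
      have h2 := congrArg TmaxPair.snd hc
      simp only [TmaxPair.add_fst, TmaxPair.add_snd, TmaxPair.neg_fst, TmaxPair.neg_snd] at h1 h2
      rw [h1, h2]
    · exact absurd hc.2.1 (lt_irrefl c)
    · exact absurd hc.2.1 (lt_irrefl c)
  · intro h
    refine ⟨a.fst + b.snd, congrArg mk ?_⟩
    ext
    · rfl
    · exact h.symm

end Smax

/-! ### Formal polynomials over the tropical semifield -/

namespace Tmax

variable {Γ : Type*} [AddCommGroup Γ] [LinearOrder Γ] [IsOrderedAddMonoid Γ]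

/-- A formal polynomial of degree `n` over the tropical semifield is factored if
`P = P_n (Y ⊕ c₁) ⋯ (Y ⊕ c_n)`, as formal polynomials, for some tropical numbers `c_i`. -/
def IsFactored (P : (Tmax Γ)[X]) : Prop :=
  ∃ c : Multiset (Tmax Γ), Multiset.card c = P.natDegree ∧
    P = C P.leadingCoeff * (c.map fun a => X + C a).prod

/-- `c` is a corner of `P`: if `c ≠ 0`, the maximum of the monomials of `P` at `c` is attained by
at least two different monomials; if `c = 0`, there is no constant term. -/
def IsCorner (P : (Tmax Γ)[X]) (c : Tmax Γ) : Prop :=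
  (c ≠ 0 ∧ ∃ i ∈ P.support, ∃ j ∈ P.support, i ≠ j ∧
    P.coeff i * c ^ i = P.eval c ∧ P.coeff j * c ^ j = P.eval c) ∨
  (c = 0 ∧ P.coeff 0 = 0)

end Tmax

/-! ### Formal polynomials over the symmetrized tropical semiring -/

namespace Smax

variable {Γ : Type*} [AddCommGroup Γ] [LinearOrder Γ] [IsOrderedAddMonoid Γ]

/-- Formal polynomials with signed coefficients. -/
def IsSignedPoly (P : (Smax Γ)[X]) : Prop := ∀ k, IsSigned (P.coeff k)

/-- The formal polynomial `|P|`, by the absolute value of each coefficient. -/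
noncomputable def absPoly (P : (Smax Γ)[X]) : (Tmax Γ)[X] := P.map (abs Γ)

/-- (Signed) roots: signed elements `y` at which the value of `P` balances `0`. -/
def IsRoot (P : (Smax Γ)[X]) (y : Smax Γ) : Prop := IsSigned y ∧ Balances (P.eval y) 0

/-- Coefficientwise balance relation. -/
def BalancesPoly (P Q : (Smax Γ)[X]) : Prop := ∀ k, Balances (P.coeff k) (Q.coeff k)

/-- `Q` is a quotient of `P` by `Y ⊖ a`: it has signed coefficients, and
`λ P ∇ (Y ⊖ a) Q` for some tangible `λ`. -/
def IsQuotientBy (a : Smax Γ) (P Q : (Smax Γ)[X]) : Prop :=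
  IsSignedPoly Q ∧ ∃ l : Smax Γ, IsTangible l ∧ BalancesPoly (C l * P) ((X + C (-a)) * Q)

/-- `MultGE a P k` says that the recursion defining the multiplicity of `a` as a root of `P` can be
unfolded so as to give at least the value `k`. -/
inductive MultGE (a : Smax Γ) : (Smax Γ)[X] → ℕ → Prop
  | zero (P : (Smax Γ)[X]) : MultGE a P 0
  | one (P : (Smax Γ)[X]) : IsRoot P a → MultGE a P 1
  | succ (P Q : (Smax Γ)[X]) (k : ℕ) :
      IsRoot P a → IsQuotientBy a P Q → MultGE a Q k → MultGE a P (k + 1)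

/-- The multiplicity of `a` as a root of a formal polynomial `P` with signed coefficients. See
`mult_of_not_isRoot` and `mult_of_isRoot` for the recursion that characterizes it: it is `0` if `a`
is not a root, and otherwise it is one plus the supremum of the multiplicities of `a` as a root of
the quotients of `P` by `Y ⊖ a`. -/
noncomputable def mult (a : Smax Γ) (P : (Smax Γ)[X]) : ℕ∞ :=
  ⨆ (k : ℕ) (_ : MultGE a P k), (k : ℕ∞)

theorem MultGE.le_mult {a : Smax Γ} {P : (Smax Γ)[X]} {k : ℕ} (h : MultGE a P k) :
    (k : ℕ∞) ≤ mult a P :=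
  le_iSup₂ (f := fun (k : ℕ) (_ : MultGE a P k) => (k : ℕ∞)) k h

theorem mult_of_not_isRoot {a : Smax Γ} {P : (Smax Γ)[X]} (h : ¬ IsRoot P a) :
    mult a P = 0 := by
  rw [← nonpos_iff_eq_zero]
  refine iSup₂_le fun k hk => ?_
  cases hk with
  | zero => simp
  | one _ h' => exact absurd h' h
  | succ _ _ _ h' _ _ => exact absurd h' h

theorem mult_of_isRoot {a : Smax Γ} {P : (Smax Γ)[X]} (h : IsRoot P a) :
    mult a P = 1 + ⨆ (Q : (Smax Γ)[X]) (_ : IsQuotientBy a P Q), mult a Q := by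
  apply le_antisymm
  · refine iSup₂_le fun k hk => ?_
    cases hk with
    | zero => simp
    | one _ h' => simp
    | succ _ Q k _ hQ hk =>
      rw [Nat.cast_add, Nat.cast_one, add_comm]
      gcongr
      exact hk.le_mult.trans
        (le_iSup₂ (f := fun (Q : (Smax Γ)[X]) (_ : IsQuotientBy a P Q) => mult a Q) Q hQ)
  · have h1 : (1 : ℕ∞) ≤ mult a P := by
      simpa using (MultGE.one P h : MultGE a P 1).le_mult
    have h2 : (⨆ (Q : (Smax Γ)[X]) (_ : IsQuotientBy a P Q), mult a Q) ≤ mult a P - 1 := by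
      refine iSup₂_le fun Q hQ => iSup₂_le fun k hk => ?_
      have := (MultGE.succ P Q k h hQ hk).le_mult
      refine ENat.le_sub_of_add_le_right (by simp) ?_
      simpa using this
    calc _ ≤ 1 + (mult a P - 1) := by gcongr
      _ = mult a P := add_tsub_cancel_of_le h1

/-- The multiset `s` of signed elements `r₁, …, r_n`, where `n` is the degree of `P`, is a
factorization of the polynomial function of `P`, that is
`P̂(y) = P_n (y ⊖ r₁) ⋯ (y ⊖ r_n)` for all `y`. -/
def IsFactorization (P : (Smax Γ)[X]) (s : Multiset (Smax Γ)) : Prop :=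
  (∀ r ∈ s, IsSigned r) ∧ Multiset.card s = P.natDegree ∧
    ∀ y : Smax Γ, P.eval y = P.leadingCoeff * (s.map fun r => y + -r).prod

/-- The sequence `r₁, …, r_n` (here `r i` is `r_{i+1}`) of signed elements determined by
`r_i P_{n-i+1} = ⊖ P_{n-i}` for `i ≤ n - m` and `r_i = 0` for `n - m < i ≤ n`, where `n` is the
degree and `m` the lower degree of `P`. -/
def IsRootSequence (P : (Smax Γ)[X]) (r : Fin P.natDegree → Smax Γ) : Prop :=
  ∀ i : Fin P.natDegree, IsSigned (r i) ∧
    ((i : ℕ) + 1 ≤ P.natDegree - P.natTrailingDegree →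
      r i * P.coeff (P.natDegree - i) = -P.coeff (P.natDegree - (i + 1))) ∧
    (P.natDegree - P.natTrailingDegree < (i : ℕ) + 1 → r i = 0)

end Smax

/-! ### Order and cancellation in the tropical semifield -/

namespace Tmax

variable {Γ : Type*} [AddCommGroup Γ] [LinearOrder Γ] [IsOrderedAddMonoid Γ]

/-! Write `n` for the degree of `P`. Since `|P|` is factored, its nonzero coefficients have no gap
and the ratios `|P_{n-i}| / |P_{n-i+1}| = |r_i|` do not increase with `i`. A signed element absorbs
any summand of smaller modulus, and also a copy of itself. So under (a) each `⊖r_i` absorbs all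
later ones, and every elementary symmetric function of the `⊖r_i` collapses to an initial product.
Hence `P = P_n (Y ⊖ r_1) ⋯ (Y ⊖ r_n)` already as formal polynomials (`IsRootSequence.eq_rootProd`).
A product of nonzero signed elements is never balanced, so the roots are exactly the `r_i`
(`isBalanced_mul_prod_iff`), and (b) follows.

If (a) fails, two consecutive `r_i` are opposite and nonzero. Two coefficients whose degrees differ
by 2 then give opposite monomials of maximal modulus at both `c` and `⊖c`, where `c` is the common
modulus, so both are roots (`IsRootSequence.isRoot_of_ne`).

Removing linear factors one at a time bounds the multiplicity from below (`multGE_rootProd`). For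
the upper bound at `x ≠ 0`, consider the degrees of the monomials of maximal modulus at `x`: their
range shrinks by at least one on passing to a quotient (`IsQuotientBy.isDominant`), and between two
such degrees all `|r_i|` equal `|x|` (`IsRootSequence.abs_eq_of_isDominant`). At `x = 0` the lower
degree is the bound.

For uniqueness, the polynomial function determines the set of factors, as the set of roots, and the
multiset of their moduli (`Tmax.multiset_eq_of_prod_map_add_eq`). Under (a) the modulus is injective
on this set, so the multiplicities of the factors are determined too. -/

theorem pos_iff_ne_zero {a : Tmax Γ} : 0 < a ↔ a ≠ 0 :=
  ⟨ne_of_gt, fun h => lt_of_le_of_ne (zero_le a) h.symm⟩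

theorem le_zero_iff {a : Tmax Γ} : a ≤ 0 ↔ a = 0 :=
  ⟨fun h => le_antisymm h (zero_le a), fun h => h.le⟩

theorem mul_right_cancel_of_ne_zero {a b c : Tmax Γ} (hc : c ≠ 0) (h : a * c = b * c) :
    a = b := by
  rcases lt_trichotomy a b with hab | hab | hab
  · exact absurd h (mul_lt_mul_right' hab (pos_iff_ne_zero.2 hc)).ne
  · exact hab
  · exact absurd h (mul_lt_mul_right' hab (pos_iff_ne_zero.2 hc)).ne'

theorem le_of_mul_le_mul_right_of_ne_zero {a b c : Tmax Γ} (hc : c ≠ 0) (h : a * c ≤ b * c) :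
    a ≤ b :=
  not_lt.1 fun hab => h.not_gt (mul_lt_mul_right' hab (pos_iff_ne_zero.2 hc))

theorem mul_le_mul_left_of_le {a b : Tmax Γ} (h : a ≤ b) (c : Tmax Γ) : c * a ≤ c * b := by
  rw [mul_comm c a, mul_comm c b]; exact mul_le_mul_right' h c

theorem mul_le_mul_of_le {a b c d : Tmax Γ} (h : a ≤ b) (h' : c ≤ d) : a * c ≤ b * d :=
  (mul_le_mul_right' h c).trans (mul_le_mul_left_of_le h' b)

instance : NoZeroDivisors (Tmax Γ) where
  eq_zero_or_eq_zero_of_mul_eq_zero {a b} h := by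
    by_contra! hab
    exact hab.1 (mul_right_cancel_of_ne_zero hab.2 (h.trans (zero_mul b).symm))

instance : Nontrivial (Tmax Γ) := ⟨⟨0, 1, WithBot.bot_ne_coe⟩⟩

theorem exists_mul_eq_one {a : Tmax Γ} (ha : a ≠ 0) : ∃ b : Tmax Γ, a * b = 1 := by
  induction a using WithBot.recBotCoe with
  | bot => exact absurd rfl ha
  | coe g =>
    refine ⟨((-g : Γ) : WithBot Γ), ?_⟩
    change (g : WithBot Γ) + ((-g : Γ) : WithBot Γ) = ((0 : Γ) : WithBot Γ)
    rw [← WithBot.coe_add, add_neg_cancel]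

theorem le_add_left (a b : Tmax Γ) : a ≤ a + b := le_max_left a b

theorem le_add_right (a b : Tmax Γ) : b ≤ a + b := le_max_right a b

theorem add_eq_left_of_le {a b : Tmax Γ} (h : b ≤ a) : a + b = a := max_eq_left h

theorem add_eq_right_of_le {a b : Tmax Γ} (h : a ≤ b) : a + b = b := max_eq_right h

theorem le_sum {ι : Type*} (s : Finset ι) (f : ι → Tmax Γ) {i : ι} (hi : i ∈ s) :
    f i ≤ ∑ j ∈ s, f j := by
  classical
  rw [← Finset.add_sum_erase s f hi]
  exact le_add_left _ _

theorem exists_sum_eq {ι : Type*} (s : Finset ι) (hs : s.Nonempty) (f : ι → Tmax Γ) :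
    ∃ i ∈ s, ∑ j ∈ s, f j = f i := by
  classical
  induction hs using Finset.Nonempty.cons_induction with
  | singleton a => exact ⟨a, by simp⟩
  | cons a s ha _ ih =>
    obtain ⟨i, hi, h⟩ := ih
    rw [Finset.sum_cons, h]
    rcases le_total (f i) (f a) with hle | hle
    · exact ⟨a, by simp, add_eq_left_of_le hle⟩
    · exact ⟨i, by simp [hi], add_eq_right_of_le hle⟩

theorem coeff_mul_pow_le_eval (P : (Tmax Γ)[X]) (c : Tmax Γ) (k : ℕ) :
    P.coeff k * c ^ k ≤ P.eval c := by
  by_cases hk : k ∈ P.support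
  · rw [eval_eq_sum, sum_def]
    exact le_sum P.support (fun k => P.coeff k * c ^ k) hk
  · rw [notMem_support_iff.1 hk, zero_mul]
    exact zero_le _

end Tmax

/-! ### Arithmetic of signed and balanced elements -/

namespace Smax

variable {Γ : Type*} [AddCommGroup Γ] [LinearOrder Γ] [IsOrderedAddMonoid Γ]

theorem exists_mk (x : Smax Γ) : ∃ a b : Tmax Γ, x = mk ⟨a, b⟩ := by
  obtain ⟨⟨a, b⟩, rfl⟩ := mk_surjective x
  exact ⟨a, b, rfl⟩

theorem mk_eq_iff {a b c d : Tmax Γ} : (mk ⟨a, b⟩ : Smax Γ) = mk ⟨c, d⟩ ↔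
    (a = c ∧ b = d) ∨ (b < a ∧ d < c ∧ a = c) ∨ (a < b ∧ c < d ∧ b = d) := by
  rw [mk_eq_mk, TmaxPair.rel_iff, TmaxPair.mk.injEq]

theorem mk_add_mk (a b c d : Tmax Γ) :
    (mk ⟨a, b⟩ + mk ⟨c, d⟩ : Smax Γ) = mk ⟨max a c, max b d⟩ :=
  (map_add mk _ _).symm

theorem mk_mul_mk (a b c d : Tmax Γ) :
    (mk ⟨a, b⟩ * mk ⟨c, d⟩ : Smax Γ) = mk ⟨a * c + b * d, a * d + b * c⟩ :=
  (map_mul mk _ _).symm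

theorem neg_mk' (a b : Tmax Γ) : (-mk ⟨a, b⟩ : Smax Γ) = mk ⟨b, a⟩ := rfl

theorem zero_eq_mk : (0 : Smax Γ) = mk ⟨0, 0⟩ := rfl

theorem abs_mk' (a b : Tmax Γ) : abs Γ (mk ⟨a, b⟩) = max a b := rfl

@[simp] theorem neg_neg'' (x : Smax Γ) : - -x = x := by
  obtain ⟨a, b, rfl⟩ := exists_mk x
  rfl

@[simp] theorem neg_zero' : -(0 : Smax Γ) = 0 := rfl

theorem neg_mul'' (x y : Smax Γ) : -x * y = -(x * y) := by
  obtain ⟨a, b, rfl⟩ := exists_mk x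
  obtain ⟨c, d, rfl⟩ := exists_mk y
  simp only [neg_mk', mk_mul_mk, add_comm]

theorem mul_neg'' (x y : Smax Γ) : x * -y = -(x * y) := by
  rw [mul_comm, neg_mul'', mul_comm]

@[simp] theorem abs_neg (x : Smax Γ) : abs Γ (-x) = abs Γ x := by
  obtain ⟨a, b, rfl⟩ := exists_mk x
  simp only [neg_mk', abs_mk', max_comm]

@[simp] theorem abs_eq_zero {x : Smax Γ} : abs Γ x = 0 ↔ x = 0 := by
  refine ⟨fun h => ?_, fun h => by rw [h, map_zero]⟩
  obtain ⟨a, b, rfl⟩ := exists_mk x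
  rw [abs_mk'] at h
  have ha : a = 0 := Tmax.le_zero_iff.1 (h ▸ le_max_left a b)
  have hb : b = 0 := Tmax.le_zero_iff.1 (h ▸ le_max_right a b)
  rw [ha, hb, zero_eq_mk]

instance : NoZeroDivisors (Smax Γ) where
  eq_zero_or_eq_zero_of_mul_eq_zero {x y} h := by
    rw [← abs_eq_zero, map_mul, mul_eq_zero, abs_eq_zero, abs_eq_zero] at h
    exact h

instance : Nontrivial (Smax Γ) :=
  ⟨⟨0, 1, fun h => zero_ne_one (α := Tmax Γ) (by simpa using congrArg (abs Γ) h)⟩⟩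

@[simp] theorem abs_pos (c : Tmax Γ) : abs Γ (pos c) = c := max_eq_left (Tmax.zero_le c)

theorem isSigned_mk {a b : Tmax Γ} :
    IsSigned (mk ⟨a, b⟩ : Smax Γ) ↔ a ≠ b ∨ (a = 0 ∧ b = 0) := by
  have ha := Tmax.zero_le a
  have hb := Tmax.zero_le b
  simp only [IsSigned, pos, neg_mk', mk_eq_iff]
  constructor
  · rintro ⟨c, hc⟩
    have := Tmax.zero_le c
    grind
  · rintro (h | h)
    · rcases lt_or_gt_of_ne h with h | h
      · exact ⟨b, Or.inr (Or.inr (Or.inr ⟨h, ha.trans_lt h, rfl⟩))⟩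
      · exact ⟨a, Or.inl (Or.inr (Or.inl ⟨h, hb.trans_lt h, rfl⟩))⟩
    · exact ⟨0, Or.inl (Or.inl h)⟩

theorem isBalanced_mk {a b : Tmax Γ} : IsBalanced (mk ⟨a, b⟩ : Smax Γ) ↔ a = b := by
  simp only [IsBalanced, mk_eq_iff]
  constructor
  · rintro ⟨c, hc⟩
    grind
  · rintro rfl
    exact ⟨a, Or.inl ⟨rfl, rfl⟩⟩

theorem balances_mk' {a b c d : Tmax Γ} :
    Balances (mk ⟨a, b⟩ : Smax Γ) (mk ⟨c, d⟩) ↔ max a d = max b c :=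
  balances_mk _ _

theorem add_self (x : Smax Γ) : x + x = x := by
  obtain ⟨a, b, rfl⟩ := exists_mk x
  simp only [mk_add_mk, max_self]

theorem isSigned_pos (c : Tmax Γ) : IsSigned (pos c : Smax Γ) := ⟨c, Or.inl rfl⟩

theorem IsSigned.neg {x : Smax Γ} (hx : IsSigned x) : IsSigned (-x) := by
  obtain ⟨c, rfl | rfl⟩ := hx
  · exact ⟨c, Or.inr rfl⟩
  · exact ⟨c, Or.inl rfl⟩

theorem isSigned_zero : IsSigned (0 : Smax Γ) := isSigned_pos 0

theorem isSigned_one : IsSigned (1 : Smax Γ) := isSigned_pos 1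

theorem pos_mul_pos (a b : Tmax Γ) : (pos a * pos b : Smax Γ) = pos (a * b) := by
  simp [pos, mk_mul_mk]

theorem IsSigned.mul {x y : Smax Γ} (hx : IsSigned x) (hy : IsSigned y) : IsSigned (x * y) := by
  obtain ⟨a, rfl | rfl⟩ := hx <;> obtain ⟨b, rfl | rfl⟩ := hy <;>
    simp only [neg_mul'', mul_neg'', pos_mul_pos, neg_neg'']
  all_goals first | exact isSigned_pos _ | exact (isSigned_pos _).neg

theorem IsSigned.listProd {l : List (Smax Γ)} (h : ∀ x ∈ l, IsSigned x) : IsSigned l.prod := by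
  induction l with
  | nil => simpa using isSigned_one
  | cons a l ih =>
    rw [List.prod_cons]
    exact (h a (by simp)).mul (ih fun x hx => h x (by simp [hx]))

theorem IsSigned.pow {x : Smax Γ} (hx : IsSigned x) (k : ℕ) : IsSigned (x ^ k) := by
  induction k with
  | zero => simpa using isSigned_one
  | succ k ih => rw [pow_succ]; exact ih.mul hx

theorem IsSigned.exists_mul_eq_one {x : Smax Γ} (hx : IsSigned x) (h0 : x ≠ 0) :
    ∃ y : Smax Γ, IsSigned y ∧ x * y = 1 := by
  obtain ⟨a, h⟩ := hx
  have ha : a ≠ 0 := by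
    rintro rfl
    rcases h with rfl | rfl <;> exact h0 rfl
  obtain ⟨b, hb⟩ := Tmax.exists_mul_eq_one ha
  rcases h with rfl | rfl
  · exact ⟨pos b, isSigned_pos b, by rw [pos_mul_pos, hb]; rfl⟩
  · exact ⟨-pos b, (isSigned_pos b).neg, by
      rw [neg_mul'', mul_neg'', neg_neg'', pos_mul_pos, hb]; rfl⟩

theorem IsSigned.mul_right_cancel {x y z : Smax Γ} (hz : IsSigned z) (h0 : z ≠ 0)
    (h : x * z = y * z) : x = y := by
  obtain ⟨w, -, hw⟩ := hz.exists_mul_eq_one h0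
  calc x = x * z * w := by rw [mul_assoc, hw, mul_one]
    _ = y := by rw [h, mul_assoc, hw, mul_one]

/-- The class of a pair with distinct entries depends only on the larger entry and its side, and
here `y` is too small to alter either. -/
theorem IsSigned.add_eq_left {x y : Smax Γ} (hx : IsSigned x) (h : abs Γ y < abs Γ x) :
    x + y = x := by
  obtain ⟨a, b, rfl⟩ := exists_mk x
  obtain ⟨c, d, rfl⟩ := exists_mk y
  have ha := Tmax.zero_le a
  have hb := Tmax.zero_le b
  have hc := Tmax.zero_le c
  rw [isSigned_mk] at hx
  rw [abs_mk', abs_mk'] at h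
  rw [mk_add_mk, mk_eq_iff]
  grind

theorem IsSigned.eq_or_eq_neg {x y : Smax Γ} (hx : IsSigned x) (hy : IsSigned y)
    (h : abs Γ x = abs Γ y) : x = y ∨ x = -y := by
  obtain ⟨a, rfl | rfl⟩ := hx <;> obtain ⟨b, rfl | rfl⟩ := hy <;>
    simp only [abs_neg, abs_pos] at h <;> subst h <;> simp

theorem IsSigned.sub {x y : Smax Γ} (hx : IsSigned x) (hy : IsSigned y) (h : x ≠ y) :
    IsSigned (x + -y) := by
  rcases lt_trichotomy (abs Γ x) (abs Γ y) with hlt | heq | hlt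
  · rw [add_comm, hy.neg.add_eq_left (by simpa using hlt)]
    exact hy.neg
  · rcases hx.eq_or_eq_neg hy heq with rfl | rfl
    · exact absurd rfl h
    · rwa [add_self]
  · rw [hx.add_eq_left (by simpa using hlt)]
    exact hx

theorem isBalanced_add_neg_self (x : Smax Γ) : IsBalanced (x + -x) := by
  obtain ⟨a, b, rfl⟩ := exists_mk x
  rw [neg_mk', mk_add_mk, isBalanced_mk, max_comm]

theorem IsBalanced.mul_right {x : Smax Γ} (hx : IsBalanced x) (y : Smax Γ) :
    IsBalanced (x * y) := by
  obtain ⟨a, rfl⟩ := hx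
  obtain ⟨c, d, rfl⟩ := exists_mk y
  rw [mk_mul_mk, isBalanced_mk, add_comm]

/-- Both entries of a balanced pair are maximal, so, unlike a signed element, it absorbs summands of
equal modulus whatever their sign. -/
theorem IsBalanced.add_eq_left {x y : Smax Γ} (hx : IsBalanced x) (h : abs Γ y ≤ abs Γ x) :
    x + y = x := by
  obtain ⟨a, rfl⟩ := hx
  obtain ⟨c, d, rfl⟩ := exists_mk y
  rw [abs_mk', abs_mk'] at h
  rw [mk_add_mk, mk_eq_iff]
  grind

theorem balances_zero_iff {x : Smax Γ} : Balances x 0 ↔ IsBalanced x := by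
  obtain ⟨a, b, rfl⟩ := exists_mk x
  rw [zero_eq_mk, balances_mk', isBalanced_mk, max_eq_left (Tmax.zero_le a),
    max_eq_left (Tmax.zero_le b)]

theorem Balances.refl (x : Smax Γ) : Balances x x := by
  obtain ⟨a, b, rfl⟩ := exists_mk x
  rw [balances_mk', max_comm]

theorem IsSigned.eq_zero_of_isBalanced {x : Smax Γ} (hx : IsSigned x) (h : IsBalanced x) :
    x = 0 := by
  obtain ⟨a, b, rfl⟩ := exists_mk x
  rw [isSigned_mk] at hx
  rw [isBalanced_mk] at h
  rw [zero_eq_mk, mk_eq_iff]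
  grind

/-- The relation `∇` is not transitive; this reduction to an equality is what makes the balances in
the definition of quotients usable. -/
theorem Balances.eq_of_isSigned {x y : Smax Γ} (h : Balances x y) (hx : IsSigned x)
    (hy : IsSigned y) : x = y := by
  obtain ⟨a, b, rfl⟩ := exists_mk x
  obtain ⟨c, d, rfl⟩ := exists_mk y
  have ha := Tmax.zero_le a
  have hb := Tmax.zero_le b
  have hc := Tmax.zero_le c
  have hd := Tmax.zero_le d
  rw [isSigned_mk] at hx hy
  rw [balances_mk'] at h
  rw [mk_eq_iff]
  grind

/-- The larger entry of a nonzero signed `x` strictly exceeds the other one, so only an entry of `y`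
can compensate it. -/
theorem Balances.abs_le_of_isSigned {x y : Smax Γ} (h : Balances x y) (hx : IsSigned x) :
    abs Γ x ≤ abs Γ y := by
  obtain ⟨a, b, rfl⟩ := exists_mk x
  obtain ⟨c, d, rfl⟩ := exists_mk y
  have hc := Tmax.zero_le c
  have hd := Tmax.zero_le d
  rw [isSigned_mk] at hx
  rw [balances_mk'] at h
  rw [abs_mk', abs_mk']
  grind

theorem eq_neg_self_iff {x : Smax Γ} (hx : IsSigned x) : x = -x ↔ x = 0 := by
  refine ⟨fun h => hx.eq_zero_of_isBalanced ?_, fun h => by rw [h, neg_zero']⟩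
  have := isBalanced_add_neg_self x
  rwa [← h, add_self] at this

end Smax

/-! ### Coefficients of products of linear forms -/

theorem Polynomial.coeff_listProd_of_length_lt {R : Type*} [CommSemiring R] (l : List R) {j : ℕ}
    (hj : l.length < j) : (l.map fun u => X + C u).prod.coeff j = 0 := by
  induction l generalizing j with
  | nil =>
    rw [List.map_nil, List.prod_nil, coeff_one, if_neg (Nat.pos_iff_ne_zero.1 hj)]
  | cons u l ih =>
    obtain _ | j := j
    · simp at hj
    · rw [List.length_cons] at hj
      rw [List.map_cons, List.prod_cons, add_mul, coeff_add, coeff_X_mul, coeff_C_mul,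
        ih (by omega), ih (by omega), mul_zero, add_zero]

/-- If every term of the list absorbs the later ones, then the elementary symmetric functions of
the list are its initial products. -/
theorem Polynomial.coeff_listProd_of_pairwise {R : Type*} [CommSemiring R] (l : List R)
    (hl : l.Pairwise fun a b => a + b = a) {j : ℕ} (hj : j ≤ l.length) :
    (l.map fun u => X + C u).prod.coeff j = (l.take (l.length - j)).prod := by
  induction l generalizing j with
  | nil => simp_all
  | cons u l ih =>
    rw [List.pairwise_cons] at hl
    rw [List.map_cons, List.prod_cons, add_mul, coeff_add, coeff_C_mul]
    obtain _ | j := j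
    · rw [coeff_X_mul_zero, zero_add, ih hl.2 (Nat.zero_le _)]
      simp
    · rw [List.length_cons] at hj
      rw [coeff_X_mul, ih hl.2 (by omega), List.length_cons]
      rcases (Nat.lt_or_ge j l.length) with h | h
      -- The two contributions are `(l.take s).prod * l[s]` and `u * (l.take s).prod`; their sum is
      -- `(u + l[s]) * (l.take s).prod`, and `u` absorbs `l[s]`.
      · obtain ⟨s, hs⟩ : ∃ s, l.length - j = s + 1 := ⟨l.length - j - 1, by omega⟩
        rw [ih hl.2 h, show l.length - (j + 1) = s by omega,
          show l.length + 1 - (j + 1) = s + 1 by omega, hs,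
          List.take_succ_cons, List.prod_cons, List.take_add_one,
          List.getElem?_eq_getElem (by omega), Option.toList_some, List.prod_append,
          List.prod_singleton, mul_comm _ l[s], ← add_mul, add_comm,
          hl.1 _ (List.getElem_mem _)]
      · rw [coeff_listProd_of_length_lt l (by omega), mul_zero, add_zero,
          show l.length - j = 0 by omega, show l.length + 1 - (j + 1) = 0 by omega]
        rfl

theorem Polynomial.eval_listProd_X_add_C {R : Type*} [CommSemiring R] (l : List R) (y : R) :
    (l.map fun u => X + C u).prod.eval y = (l.map fun u => y + u).prod := by
  rw [eval_list_prod, List.map_map]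
  congr 1
  exact List.map_congr_left fun u _ => by simp

theorem le_natCard_of_forall_eq {α : Type*} {n : ℕ} (f : Fin n → α) (x : α) {a b : ℕ} (hb : b ≤ n)
    (h : ∀ i : Fin n, a ≤ i → (i : ℕ) < b → f i = x) : b - a ≤ Nat.card {i // f i = x} := by
  have := Nat.card_le_card_of_injective
    (fun t : Fin (b - a) => (⟨⟨a + t, by omega⟩, h _ (by simp) (by simp; omega)⟩ :
      {i // f i = x}))
    (fun t u htu => by
      have := congrArg (fun z : {i // f i = x} => ((z : Fin n) : ℕ)) htu
      ext
      simpa using this)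
  simpa using this

/-! ### Tropical product functions and their factors -/

namespace Tmax

variable {Γ : Type*} [AddCommGroup Γ] [LinearOrder Γ] [IsOrderedAddMonoid Γ]

/-- Half of `a + b` (sum in `Γ`) lies strictly between finite `a` and `b`; if `a` is `⊥`, a
nontrivial group has an element below `b`. This is where divisibility and nontriviality enter. -/
theorem exists_between_of_divisible [Nontrivial Γ]
    (hdiv : ∀ n : ℕ, 0 < n → ∀ a : Γ, ∃ b : Γ, n • b = a) {a b : Tmax Γ} (h : a < b) :
    ∃ c : Tmax Γ, c ≠ 0 ∧ a < c ∧ c < b := by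
  induction b using WithBot.recBotCoe with
  | bot => exact absurd h (zero_le a).not_gt
  | coe b =>
    induction a using WithBot.recBotCoe with
    | bot =>
      obtain ⟨d, hd⟩ := exists_lt b
      exact ⟨(d : WithBot Γ), WithBot.coe_ne_bot, WithBot.bot_lt_coe d, WithBot.coe_lt_coe.2 hd⟩
    | coe a =>
      have h' : a < b := WithBot.coe_lt_coe.1 h
      obtain ⟨d, hd⟩ := hdiv 2 two_pos (a + b)
      rw [two_nsmul] at hd
      refine ⟨(d : WithBot Γ), WithBot.coe_ne_bot, WithBot.coe_lt_coe.2 ?_,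
        WithBot.coe_lt_coe.2 ?_⟩
      · by_contra! hc
        exact absurd hd (add_lt_add_of_le_of_lt hc (hc.trans_lt h')).ne
      · by_contra! hc
        exact absurd hd (add_lt_add_of_lt_of_le (h'.trans_le hc) hc).ne'

theorem pow_le_prod_map_add (s : Multiset (Tmax Γ)) (y : Tmax Γ) :
    y ^ Multiset.card s ≤ (s.map fun u => y + u).prod := by
  induction s using Multiset.induction_on with
  | empty => simp
  | cons u s ih =>
    rw [Multiset.card_cons, Multiset.map_cons, Multiset.prod_cons, pow_succ, mul_comm]
    exact mul_le_mul_of_le (le_add_left _ _) ih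

theorem prod_map_add_of_le (s : Multiset (Tmax Γ)) (y : Tmax Γ) (h : ∀ u ∈ s, u ≤ y) :
    (s.map fun u => y + u).prod = y ^ Multiset.card s := by
  rw [Multiset.map_congr rfl fun u hu => add_eq_left_of_le (h u hu), Multiset.map_const',
    Multiset.prod_replicate]

/-- Otherwise take `y` strictly between the largest element of `t` and `M`. Every factor of the
product over `t` is then `y`, whereas the product over `s` contains the factor `M > y` and its other
factors are at least `y`. -/
theorem mem_of_prod_map_add_eq [Nontrivial Γ]
    (hdiv : ∀ n : ℕ, 0 < n → ∀ a : Γ, ∃ b : Γ, n • b = a) {s t : Multiset (Tmax Γ)}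
    (hcard : Multiset.card s = Multiset.card t)
    (h : ∀ y : Tmax Γ, y ≠ 0 → (s.map fun u => y + u).prod = (t.map fun u => y + u).prod)
    {M : Tmax Γ} (hM : M ∈ s) (ht : ∀ u ∈ t, u ≤ M) : M ∈ t := by
  by_contra hMt
  have key : ∃ y : Tmax Γ, y ≠ 0 ∧ y < M ∧ ∀ u ∈ t, u ≤ y := by
    have hne : t ≠ 0 := by
      rintro rfl
      rw [Multiset.card_zero, Multiset.card_eq_zero] at hcard
      rw [hcard] at hM
      simp at hM
    obtain ⟨N, hN, hmax⟩ := t.exists_max_image id hne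
    obtain ⟨y, hy0, hy, hyM⟩ := exists_between_of_divisible hdiv
      (lt_of_le_of_ne (ht N hN) fun e => hMt (e ▸ hN))
    exact ⟨y, hy0, hyM, fun u hu => (hmax u hu).trans hy.le⟩
  obtain ⟨y, hy0, hyM, hty⟩ := key
  have h1 := h y hy0
  obtain ⟨s', rfl⟩ := Multiset.exists_cons_of_mem hM
  rw [prod_map_add_of_le t y hty, ← hcard, Multiset.card_cons, Multiset.map_cons,
    Multiset.prod_cons, add_eq_right_of_le hyM.le, pow_succ'] at h1
  have hpow : 0 < y ^ Multiset.card s' := pos_iff_ne_zero.2 (pow_ne_zero _ hy0)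
  exact absurd h1.symm ((mul_lt_mul_right' hyM hpow).trans_le
    (mul_le_mul_left_of_le (pow_le_prod_map_add s' y) M)).ne

/-- Over a non-trivial divisible group, a product of tropical linear forms determines its
factors. -/
theorem multiset_eq_of_prod_map_add_eq [Nontrivial Γ]
    (hdiv : ∀ n : ℕ, 0 < n → ∀ a : Γ, ∃ b : Γ, n • b = a) (n : ℕ) (s t : Multiset (Tmax Γ))
    (hs : Multiset.card s = n) (ht : Multiset.card t = n)
    (h : ∀ y : Tmax Γ, y ≠ 0 → (s.map fun u => y + u).prod = (t.map fun u => y + u).prod) :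
    s = t := by
  induction n generalizing s t with
  | zero => rw [Multiset.card_eq_zero.1 hs, Multiset.card_eq_zero.1 ht]
  | succ n ih =>
    -- The largest element of `s + t` belongs to both multisets. Its factor `y + M` is nonzero since
    -- `y` is, so it can be cancelled.
    have key : ∃ M, M ∈ s ∧ M ∈ t := by
      have hne : s + t ≠ 0 := by
        rw [← Multiset.card_pos, Multiset.card_add]
        omega
      obtain ⟨M, hM, hmax⟩ := (s + t).exists_max_image id hne
      rcases Multiset.mem_add.1 hM with hM | hM
      · exact ⟨M, hM, mem_of_prod_map_add_eq hdiv (hs.trans ht.symm) h hM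
          fun u hu => hmax u (Multiset.mem_add.2 (Or.inr hu))⟩
      · exact ⟨M, mem_of_prod_map_add_eq hdiv (ht.trans hs.symm) (fun y hy => (h y hy).symm) hM
          fun u hu => hmax u (Multiset.mem_add.2 (Or.inl hu)), hM⟩
    obtain ⟨M, hMs, hMt⟩ := key
    obtain ⟨s, rfl⟩ := Multiset.exists_cons_of_mem hMs
    obtain ⟨t, rfl⟩ := Multiset.exists_cons_of_mem hMt
    rw [Multiset.card_cons] at hs ht
    rw [ih s t (by omega) (by omega) fun y hy => ?_]
    have hy' := h y hy
    rw [Multiset.map_cons, Multiset.map_cons, Multiset.prod_cons, Multiset.prod_cons,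
      mul_comm, mul_comm (y + M)] at hy'
    exact mul_right_cancel_of_ne_zero
      (pos_iff_ne_zero.1 ((pos_iff_ne_zero.2 hy).trans_le (le_add_left y M))) hy'

end Tmax

/-! ### Products of linear factors: roots and lower bound for the multiplicity -/

namespace Smax

variable {Γ : Type*} [AddCommGroup Γ] [LinearOrder Γ] [IsOrderedAddMonoid Γ]

theorem IsSigned.add_eq_left_of_le {x y : Smax Γ} (hx : IsSigned x)
    (h : abs Γ y ≤ abs Γ x) (h' : abs Γ y = abs Γ x → y = x) : x + y = x := by
  rcases h.lt_or_eq with h | h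
  · exact hx.add_eq_left h
  · rw [h' h, add_self]

/-- If `y` is not in `s`, every factor `y ⊖ r` is signed and nonzero, hence so is the product, which
therefore is not balanced. If `y` is in `s`, the factor `y ⊖ y` is balanced, and multiples of
balanced elements are balanced. -/
theorem isBalanced_mul_prod_iff {a : Smax Γ} (ha : IsSigned a) (ha0 : a ≠ 0)
    {s : Multiset (Smax Γ)} (hs : ∀ r ∈ s, IsSigned r) {y : Smax Γ} (hy : IsSigned y) :
    IsBalanced (a * (s.map fun r => y + -r).prod) ↔ y ∈ s := by
  constructor
  · intro h
    by_contra hys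
    -- Induction over submultisets of `s` keeps available that `y` differs from each factor.
    have key : ∀ t ≤ s, IsSigned (a * (t.map fun r => y + -r).prod) ∧
        a * (t.map fun r => y + -r).prod ≠ 0 := by
      intro t
      induction t using Multiset.induction_on with
      | empty => simp [ha, ha0]
      | cons u t ih =>
        intro ht
        obtain ⟨h1, h2⟩ := ih ((Multiset.le_cons_self t u).trans ht)
        have hu : u ∈ s := Multiset.mem_of_le ht (Multiset.mem_cons_self u t)
        have hyu : y ≠ u := fun e => hys (e ▸ hu)
        have h3 := hy.sub (hs u hu) hyu
        have h4 : y + -u ≠ 0 := by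
          intro e
          have e' := congrArg (abs Γ) e
          rw [map_add, abs_neg, map_zero] at e'
          have hy0 : y = 0 := abs_eq_zero.1 (Tmax.le_zero_iff.1 (e' ▸ Tmax.le_add_left _ _))
          have hu0 : u = 0 := abs_eq_zero.1 (Tmax.le_zero_iff.1 (e' ▸ Tmax.le_add_right _ _))
          exact hyu (hy0.trans hu0.symm)
        rw [Multiset.map_cons, Multiset.prod_cons, mul_left_comm]
        exact ⟨h3.mul h1, mul_ne_zero h4 h2⟩
    obtain ⟨h1, h2⟩ := key s le_rfl
    exact h2 (h1.eq_zero_of_isBalanced h)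
  · intro h
    obtain ⟨t, rfl⟩ := Multiset.exists_cons_of_mem h
    rw [Multiset.map_cons, Multiset.prod_cons, mul_left_comm]
    exact (isBalanced_add_neg_self y).mul_right _

/-- The product `a (Y ⊖ s₁) ⋯ (Y ⊖ s_n)` of formal polynomials. -/
noncomputable def rootProd (a : Smax Γ) (l : List (Smax Γ)) : (Smax Γ)[X] :=
  C a * ((l.map fun s => -s).map fun u => X + C u).prod

theorem eval_rootProd (a : Smax Γ) (l : List (Smax Γ)) (y : Smax Γ) :
    (rootProd a l).eval y = a * ((l : Multiset (Smax Γ)).map fun r => y + -r).prod := by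
  rw [rootProd, eval_mul, eval_C, eval_listProd_X_add_C, List.map_map, Multiset.map_coe,
    Multiset.prod_coe]
  rfl

theorem isRoot_rootProd_iff {a : Smax Γ} (ha : IsSigned a) (ha0 : a ≠ 0)
    {l : List (Smax Γ)} (hl : ∀ r ∈ l, IsSigned r) {y : Smax Γ} :
    IsRoot (rootProd a l) y ↔ y ∈ l := by
  constructor
  · rintro ⟨hy, h⟩
    rw [balances_zero_iff, eval_rootProd, isBalanced_mul_prod_iff ha ha0 (by simpa using hl) hy] at h
    simpa using h
  · intro h
    refine ⟨hl y h, ?_⟩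
    rw [balances_zero_iff, eval_rootProd,
      isBalanced_mul_prod_iff ha ha0 (by simpa using hl) (hl y h)]
    simpa using h

theorem coeff_rootProd (a : Smax Γ) {l : List (Smax Γ)}
    (hl : (l.map fun s => -s).Pairwise fun a b => a + b = a) {j : ℕ} (hj : j ≤ l.length) :
    (rootProd a l).coeff j = a * ((l.map fun s => -s).take (l.length - j)).prod := by
  rw [rootProd, coeff_C_mul, coeff_listProd_of_pairwise _ hl (by simpa using hj), List.length_map]

theorem coeff_rootProd_of_length_lt (a : Smax Γ) {l : List (Smax Γ)} {j : ℕ}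
    (hj : l.length < j) : (rootProd a l).coeff j = 0 := by
  rw [rootProd, coeff_C_mul, coeff_listProd_of_length_lt _ (by simpa using hj), mul_zero]

/-- Absorption reduces each coefficient to one product of signed elements. Without it balanced
coefficients can occur, as in `(Y ⊖ 1)(Y ⊕ 1)`. -/
theorem isSignedPoly_rootProd {a : Smax Γ} (ha : IsSigned a) {l : List (Smax Γ)}
    (hs : ∀ r ∈ l, IsSigned r) (hl : (l.map fun s => -s).Pairwise fun a b => a + b = a) :
    IsSignedPoly (rootProd a l) := by
  intro j
  rcases le_or_gt j l.length with hj | hj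
  · rw [coeff_rootProd a hl hj]
    refine ha.mul (IsSigned.listProd fun x hx => ?_)
    obtain ⟨r, hr, rfl⟩ := List.mem_map.1 (List.mem_of_mem_take hx)
    exact (hs r hr).neg
  · rw [coeff_rootProd_of_length_lt a hj]
    exact isSigned_zero

theorem rootProd_eq_of_mem (a : Smax Γ) {l : List (Smax Γ)} {x : Smax Γ} [DecidableEq (Smax Γ)]
    (hx : x ∈ l) : rootProd a l = (X + C (-x)) * rootProd a (l.erase x) := by
  have := ((List.perm_cons_erase hx).map fun s => -s).map fun u => (X + C u : (Smax Γ)[X])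
  rw [rootProd, this.prod_eq, List.map_cons, List.map_cons, List.prod_cons, mul_left_comm]
  rfl

/-- Erasing one occurrence of `x` leaves a sublist, which is still absorbing; its product is thus a
legitimate quotient, with `λ = 1`. -/
theorem multGE_rootProd {a : Smax Γ} (ha : IsTangible a) (x : Smax Γ) [DecidableEq (Smax Γ)]
    (k : ℕ) {l : List (Smax Γ)} (hs : ∀ r ∈ l, IsSigned r)
    (hl : (l.map fun s => -s).Pairwise fun a b => a + b = a) (hk : k ≤ l.count x) :
    MultGE x (rootProd a l) k := by
  induction k generalizing l with
  | zero => exact MultGE.zero _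
  | succ k ih =>
    have hx : x ∈ l := List.count_pos_iff.1 (by omega)
    have hsub : (l.erase x).Sublist l := List.erase_sublist
    have hs' : ∀ r ∈ l.erase x, IsSigned r := fun r hr => hs r (hsub.subset hr)
    have hl' := hl.sublist (hsub.map fun s => -s)
    refine MultGE.succ _ (rootProd a (l.erase x)) k
      ((isRoot_rootProd_iff ha.1 ha.2 hs).2 hx)
      ⟨isSignedPoly_rootProd ha.1 hs' hl', 1, ⟨isSigned_one, one_ne_zero⟩, ?_⟩
      (ih hs' hl' (by rw [List.count_erase_self]; omega))
    rw [C_1, one_mul, ← rootProd_eq_of_mem a hx]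
    exact fun j => Balances.refl _

/-! ### Upper bounds for the multiplicity -/

/-- A quotient by `Y` shifts the coefficients by one degree, so each unfolding of the multiplicity
of `0` kills one more low coefficient. -/
theorem MultGE.coeff_eq_zero {P : (Smax Γ)[X]} {k : ℕ} (h : MultGE 0 P k) (hP : IsSignedPoly P)
    {j : ℕ} (hj : j < k) : P.coeff j = 0 := by
  induction h generalizing j with
  | zero P => omega
  | one P h =>
    obtain rfl : j = 0 := by omega
    have := balances_zero_iff.1 h.2
    rw [← coeff_zero_eq_eval_zero] at this
    exact (hP 0).eq_zero_of_isBalanced this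
  | succ P Q k _ hQ _ ih =>
    obtain ⟨hQs, c, hc, hb⟩ := hQ
    have hbj := hb j
    rw [neg_zero', C_0, add_zero, coeff_C_mul] at hbj
    have hz : (X * Q).coeff j = 0 := by
      obtain _ | j := j
      · rw [coeff_X_mul_zero]
      · rw [coeff_X_mul, ih hQs (by omega)]
    rw [hz] at hbj
    exact (mul_eq_zero.1 (hbj.eq_of_isSigned (hc.1.mul (hP j)) isSigned_zero)).resolve_left hc.2

/-- The monomial of degree `k` of `P` has maximal modulus at `x`. -/
def IsDominant (P : (Smax Γ)[X]) (x : Smax Γ) (k : ℕ) : Prop :=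
  abs Γ (P.coeff k * x ^ k) = abs Γ (P.eval x)

theorem abs_eval (P : (Smax Γ)[X]) (x : Smax Γ) :
    abs Γ (P.eval x) = (absPoly P).eval (abs Γ x) := by
  rw [absPoly, eval_map, ← eval₂_hom]

theorem abs_coeff_mul_pow_le (P : (Smax Γ)[X]) (x : Smax Γ) (k : ℕ) :
    abs Γ (P.coeff k * x ^ k) ≤ abs Γ (P.eval x) := by
  have := Tmax.coeff_mul_pow_le_eval (absPoly P) (abs Γ x) k
  rwa [absPoly, coeff_map, ← map_pow, ← map_mul, ← absPoly, ← abs_eval] at this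

theorem eval_ne_zero {P : (Smax Γ)[X]} (hP : P ≠ 0) {x : Smax Γ} (hx : x ≠ 0) :
    P.eval x ≠ 0 := by
  intro h
  have := abs_coeff_mul_pow_le P x P.natDegree
  rw [h, map_zero, Tmax.le_zero_iff, abs_eq_zero] at this
  exact mul_ne_zero (leadingCoeff_ne_zero.2 hP) (pow_ne_zero _ hx) this

theorem exists_isDominant {P : (Smax Γ)[X]} (hP : P ≠ 0) (x : Smax Γ) :
    ∃ k, IsDominant P x k := by
  obtain ⟨i, -, hi⟩ := Tmax.exists_sum_eq P.support (support_nonempty.2 hP)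
    fun k => abs Γ (P.coeff k * x ^ k)
  exact ⟨i, by rw [IsDominant, ← hi, eval_eq_sum, sum_def, map_sum]⟩

theorem IsDominant.coeff_ne_zero {P : (Smax Γ)[X]} {x : Smax Γ} {k : ℕ} (h : IsDominant P x k)
    (hP : P ≠ 0) (hx : x ≠ 0) : P.coeff k ≠ 0 := by
  intro h0
  rw [IsDominant, h0, zero_mul, map_zero] at h
  exact eval_ne_zero hP hx (abs_eq_zero.1 h.symm)

theorem exists_isDominant_least_greatest {P : (Smax Γ)[X]} (hP : P ≠ 0) {x : Smax Γ}
    (hx : x ≠ 0) : ∃ i j, IsDominant P x i ∧ IsDominant P x j ∧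
      ∀ k, IsDominant P x k → i ≤ k ∧ k ≤ j := by
  classical
  have hex := exists_isDominant hP x
  have hle : ∀ k, IsDominant P x k → k ≤ P.natDegree := fun k hk =>
    le_natDegree_of_ne_zero (hk.coeff_ne_zero hP hx)
  obtain ⟨k, hk⟩ := hex
  exact ⟨Nat.find ⟨k, hk⟩, Nat.findGreatest (IsDominant P x) P.natDegree, Nat.find_spec ⟨k, hk⟩,
    Nat.findGreatest_spec (hle k hk) hk,
    fun k' hk' => ⟨Nat.find_min' _ hk', Nat.le_findGreatest (hle k' hk') hk'⟩⟩

/-- A single dominant monomial would absorb all the others, and the value of `P` would be signed and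
nonzero, hence not balanced. -/
theorem IsRoot.exists_isDominant_ne {P : (Smax Γ)[X]} (hP : P ≠ 0) (hPs : IsSignedPoly P)
    {x : Smax Γ} (hx : x ≠ 0) (h : IsRoot P x) {i : ℕ} (hi : IsDominant P x i) :
    ∃ j, IsDominant P x j ∧ j ≠ i := by
  by_contra! hu
  have hi0 := hi.coeff_ne_zero hP hx
  have hsum : P.eval x = P.coeff i * x ^ i + ∑ k ∈ P.support.erase i, P.coeff k * x ^ k := by
    rw [eval_eq_sum, sum_def,
      Finset.add_sum_erase _ (fun k => P.coeff k * x ^ k) (mem_support_iff.2 hi0)]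
  have hsig : IsSigned (P.coeff i * x ^ i) := (hPs i).mul (h.1.pow i)
  rw [hsig.add_eq_left] at hsum
  · have := balances_zero_iff.1 h.2
    rw [hsum] at this
    exact eval_ne_zero hP hx (hsum.trans (hsig.eq_zero_of_isBalanced this))
  · rw [map_sum]
    rcases (P.support.erase i).eq_empty_or_nonempty with he | he
    · rw [he, Finset.sum_empty, Tmax.pos_iff_ne_zero, Ne, abs_eq_zero]
      exact mul_ne_zero hi0 (pow_ne_zero _ hx)
    · obtain ⟨k, hk, hks⟩ := Tmax.exists_sum_eq _ he fun k => abs Γ (P.coeff k * x ^ k)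
      rw [hks, hi]
      exact lt_of_le_of_ne (abs_coeff_mul_pow_le P x k) fun e =>
        (Finset.mem_erase.1 hk).1 (hu k e)

/-- Let `i₀` and `j₀` be the extreme dominant degrees of `Q` at `x`. In degrees `i₀` and `j₀ + 1`,
one term of the coefficient of `(Y ⊖ x) Q` strictly exceeds the other, so the balance with `λ P` is
an equality there, and both degrees are dominant for `P`. -/
theorem IsQuotientBy.isDominant {P Q : (Smax Γ)[X]} {x : Smax Γ} (hP : P ≠ 0)
    (hPs : IsSignedPoly P) (hxs : IsSigned x) (hx : x ≠ 0) (h : IsQuotientBy x P Q) :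
    Q ≠ 0 ∧ ∀ i j, IsDominant Q x i → IsDominant Q x j →
      ∃ i' j', IsDominant P x i' ∧ IsDominant P x j' ∧ i' ≤ i ∧ j + 1 ≤ j' := by
  obtain ⟨hQs, c, hc, hb⟩ := h
  have hc0 : abs Γ c ≠ 0 := fun e => hc.2 (abs_eq_zero.1 e)
  have hb0 : Balances (c * P.coeff 0) (-x * Q.coeff 0) := by
    simpa [add_mul] using hb 0
  have hb1 : ∀ k, Balances (c * P.coeff (k + 1)) (Q.coeff k + -x * Q.coeff (k + 1)) := by
    intro k
    simpa [add_mul, coeff_X_mul] using hb (k + 1)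
  have hQ : Q ≠ 0 := by
    rintro rfl
    refine hP (Polynomial.ext fun k => ?_)
    have := hb k
    rw [mul_zero, coeff_C_mul, coeff_zero] at this
    simpa [hc.2] using this.eq_of_isSigned (hc.1.mul (hPs k)) isSigned_zero
  refine ⟨hQ, fun i j hi hj => ?_⟩
  -- Common upper bound for the monomials of `λ P` at `x`; by `hdom`, any monomial that reaches it
  -- is dominant.
  have hle : ∀ k, abs Γ c * abs Γ (P.coeff k * x ^ k) ≤ abs Γ x * abs Γ (Q.eval x) := by
    intro k
    obtain _ | k := k
    · have := hb0.abs_le_of_isSigned (hc.1.mul (hPs 0))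
      simp only [map_mul, abs_neg] at this
      simp only [pow_zero, mul_one]
      refine this.trans (Tmax.mul_le_mul_left_of_le ?_ _)
      simpa using abs_coeff_mul_pow_le Q x 0
    · have := (hb1 k).abs_le_of_isSigned (hc.1.mul (hPs _))
      have h1 := abs_coeff_mul_pow_le Q x k
      have h2 := abs_coeff_mul_pow_le Q x (k + 1)
      simp only [map_mul, map_add, abs_neg, map_pow] at this h1 h2 ⊢
      calc _ = abs Γ c * abs Γ (P.coeff (k + 1)) * abs Γ x ^ (k + 1) := by ring
        _ ≤ _ := Tmax.mul_le_mul_right' this _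
        _ = abs Γ x * (abs Γ (Q.coeff k) * abs Γ x ^ k) +
            abs Γ x * (abs Γ (Q.coeff (k + 1)) * abs Γ x ^ (k + 1)) := by ring
        _ ≤ _ := max_le (Tmax.mul_le_mul_left_of_le h1 _) (Tmax.mul_le_mul_left_of_le h2 _)
  have hdom : ∀ k, abs Γ c * abs Γ (P.coeff k * x ^ k) = abs Γ x * abs Γ (Q.eval x) →
      IsDominant P x k := by
    intro k hk
    refine le_antisymm (abs_coeff_mul_pow_le P x k) ?_
    obtain ⟨m, hm⟩ := exists_isDominant hP x
    rw [← hm]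
    refine Tmax.le_of_mul_le_mul_right_of_ne_zero hc0 ?_
    rw [mul_comm _ (abs Γ c), mul_comm _ (abs Γ c), hk]
    exact hle m
  obtain ⟨i₀, j₀, hi₀, hj₀, hij⟩ := exists_isDominant_least_greatest hQ hx
  refine ⟨i₀, j₀ + 1, hdom _ ?_, hdom _ ?_, (hij i hi).1, Nat.succ_le_succ (hij j hj).2⟩
  -- The degree below `i₀`, if any, is not dominant for `Q`, so `⊖x Q_{i₀}` absorbs `Q_{i₀-1}`.
  · have key : c * P.coeff i₀ = -x * Q.coeff i₀ := by
      obtain _ | k := i₀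
      · exact hb0.eq_of_isSigned (hc.1.mul (hPs 0)) (hxs.neg.mul (hQs 0))
      · have hk : ¬ IsDominant Q x k := fun hk => by have := (hij k hk).1; omega
        have hlt : abs Γ (Q.coeff k) < abs Γ (-x * Q.coeff (k + 1)) := by
          by_contra! hge
          refine hk (le_antisymm (abs_coeff_mul_pow_le Q x k) ?_)
          rw [← hi₀, map_mul, map_mul, map_pow, map_pow]
          have := Tmax.mul_le_mul_right' hge (abs Γ x ^ k)
          rw [map_mul, abs_neg] at this
          convert this using 1
          ring
        have := hb1 k
        rw [add_comm (Q.coeff k), (hxs.neg.mul (hQs _)).add_eq_left hlt] at this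
        exact this.eq_of_isSigned (hc.1.mul (hPs _)) (hxs.neg.mul (hQs _))
    rw [← hi₀, ← map_mul, ← mul_assoc, key]
    simp only [map_mul, abs_neg, mul_assoc]
  -- Symmetrically, degree `j₀ + 1` is not dominant for `Q`, so `Q_{j₀}` absorbs `⊖x Q_{j₀+1}`.
  · have key : c * P.coeff (j₀ + 1) = Q.coeff j₀ := by
      have hk : ¬ IsDominant Q x (j₀ + 1) := fun hk => by have := (hij _ hk).2; omega
      have hlt : abs Γ (-x * Q.coeff (j₀ + 1)) < abs Γ (Q.coeff j₀) := by
        by_contra! hge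
        refine hk (le_antisymm (abs_coeff_mul_pow_le Q x _) ?_)
        rw [← hj₀, map_mul, map_mul, map_pow, map_pow]
        have := Tmax.mul_le_mul_right' hge (abs Γ x ^ j₀)
        rw [map_mul, abs_neg] at this
        convert this using 1
        ring
      have := hb1 j₀
      rw [(hQs _).add_eq_left hlt] at this
      exact this.eq_of_isSigned (hc.1.mul (hPs _)) (hQs _)
    rw [← hj₀, ← map_mul, ← mul_assoc, key]
    simp only [map_mul, map_pow]
    ring

/-- A root of multiplicity at least `k` has at least `k + 1` dominant monomials; more precisely,
the degrees of these monomials spread over a range of length at least `k`. -/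
theorem MultGE.exists_isDominant {x : Smax Γ} (hxs : IsSigned x) (hx : x ≠ 0) {P : (Smax Γ)[X]}
    {k : ℕ} (h : MultGE x P k) (hPs : IsSignedPoly P) (hP : P ≠ 0) :
    ∃ i j, IsDominant P x i ∧ IsDominant P x j ∧ i + k ≤ j := by
  induction h with
  | zero P =>
    obtain ⟨i, hi⟩ := Smax.exists_isDominant hP x
    exact ⟨i, i, hi, hi, le_rfl⟩
  | one P h =>
    obtain ⟨i, hi⟩ := Smax.exists_isDominant hP x
    obtain ⟨j, hj, hij⟩ := h.exists_isDominant_ne hP hPs hx hi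
    rcases lt_or_gt_of_ne hij with hlt | hlt
    · exact ⟨j, i, hj, hi, hlt⟩
    · exact ⟨i, j, hi, hj, hlt⟩
  | succ P Q k _ hQ _ ih =>
    obtain ⟨hQ0, hstep⟩ := hQ.isDominant hP hPs hxs hx
    obtain ⟨i, j, hi, hj, hij⟩ := ih hQ.1 hQ0
    obtain ⟨i', j', hi', hj', h1, h2⟩ := hstep i j hi hj
    exact ⟨i', j', hi', hj', by omega⟩

end Smax

/-! ### Factored polynomials and the root sequence -/

namespace Tmax

variable {Γ : Type*} [AddCommGroup Γ] [LinearOrder Γ] [IsOrderedAddMonoid Γ]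

/-- Sorted decreasingly, the tropical factors form an absorbing list, so the coefficients are its
initial products up to the leading coefficient. -/
theorem IsFactored.exists_antitone {p : (Tmax Γ)[X]} (h : IsFactored p) :
    ∃ c : Fin p.natDegree → Tmax Γ, Antitone c ∧ ∀ i : Fin p.natDegree,
      p.coeff (p.natDegree - (i + 1)) = c i * p.coeff (p.natDegree - i) := by
  obtain ⟨s, hcard, hs⟩ := h
  obtain ⟨l, hl, hlp⟩ : ∃ l : List (Tmax Γ), l.Pairwise (· ≥ ·) ∧ (l : Multiset (Tmax Γ)) = s :=
    ⟨s.sort (· ≥ ·), s.pairwise_sort _, s.sort_eq _⟩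
  subst hlp
  rw [Multiset.coe_card] at hcard
  rw [Multiset.map_coe, Multiset.prod_coe] at hs
  have hcoeff : ∀ t ≤ p.natDegree,
      p.coeff (p.natDegree - t) = p.leadingCoeff * (l.take t).prod := by
    intro t ht
    have := congrArg (fun q => q.coeff (p.natDegree - t)) hs
    simp only [coeff_C_mul] at this
    rw [this, coeff_listProd_of_pairwise l (hl.imp fun h => add_eq_left_of_le h) (by omega),
      show l.length - (p.natDegree - t) = t by omega]
  refine ⟨fun i => l[(i : ℕ)], fun i j hij => ?_, fun i => ?_⟩
  · rcases hij.eq_or_lt with rfl | hlt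
    · exact le_rfl
    · exact List.pairwise_iff_getElem.1 hl i j (by omega) (by omega) hlt
  · rw [hcoeff _ i.2, hcoeff i i.2.le, List.take_add_one, List.getElem?_eq_getElem (by omega),
      Option.toList_some, List.prod_append, List.prod_singleton]
    ring

end Tmax

namespace Smax

variable {Γ : Type*} [AddCommGroup Γ] [LinearOrder Γ] [IsOrderedAddMonoid Γ]

theorem natDegree_absPoly (P : (Smax Γ)[X]) : (absPoly P).natDegree = P.natDegree := by
  by_cases hP : P = 0
  · rw [hP, absPoly, Polynomial.map_zero, natDegree_zero, natDegree_zero]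
  · exact natDegree_map_of_leadingCoeff_ne_zero _
      fun h => hP (leadingCoeff_eq_zero.1 (abs_eq_zero.1 h))

theorem exists_antitone_of_isFactored {P : (Smax Γ)[X]} (h : Tmax.IsFactored (absPoly P)) :
    ∃ c : Fin P.natDegree → Tmax Γ, Antitone c ∧ ∀ i : Fin P.natDegree,
      abs Γ (P.coeff (P.natDegree - (i + 1))) = c i * abs Γ (P.coeff (P.natDegree - i)) := by
  have := h.exists_antitone
  rw [natDegree_absPoly] at this
  simpa only [absPoly, coeff_map] using this

/-- By the recurrence, a zero coefficient forces all lower ones to vanish, down to the trailing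
coefficient, which is nonzero. -/
theorem coeff_ne_zero_of_isFactored {P : (Smax Γ)[X]} (hP0 : P ≠ 0)
    (h : Tmax.IsFactored (absPoly P)) {i : ℕ} (hi : i ≤ P.natDegree - P.natTrailingDegree) :
    P.coeff (P.natDegree - i) ≠ 0 := by
  obtain ⟨c, -, hc⟩ := exists_antitone_of_isFactored h
  intro h0
  have key : ∀ t, i ≤ t → t ≤ P.natDegree → P.coeff (P.natDegree - t) = 0 := by
    intro t hit
    induction t, hit using Nat.le_induction with
    | base => exact fun _ => h0
    | succ t _ ih =>
      intro ht
      have := hc ⟨t, ht⟩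
      rw [ih (by omega), map_zero, mul_zero, abs_eq_zero] at this
      exact this
  have := key _ hi (Nat.sub_le _ _)
  rw [Nat.sub_sub_self P.natTrailingDegree_le_natDegree] at this
  exact hP0 (trailingCoeff_eq_zero.1 this)

theorem existsUnique_isRootSequence {P : (Smax Γ)[X]} (hP0 : P ≠ 0) (hP : IsSignedPoly P)
    (h : Tmax.IsFactored (absPoly P)) :
    ∃! r : Fin P.natDegree → Smax Γ, IsRootSequence P r := by
  have hne := fun i => coeff_ne_zero_of_isFactored hP0 h (i := i)
  have hex : ∀ i : Fin P.natDegree, ∃ x : Smax Γ, IsSigned x ∧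
      ((i : ℕ) + 1 ≤ P.natDegree - P.natTrailingDegree →
        x * P.coeff (P.natDegree - i) = -P.coeff (P.natDegree - (i + 1))) ∧
      (P.natDegree - P.natTrailingDegree < (i : ℕ) + 1 → x = 0) := by
    intro i
    rcases le_or_gt ((i : ℕ) + 1) (P.natDegree - P.natTrailingDegree) with hi | hi
    · obtain ⟨w, hw, hw1⟩ := (hP (P.natDegree - i)).exists_mul_eq_one (hne i (by omega))
      refine ⟨-P.coeff (P.natDegree - (i + 1)) * w, (hP _).neg.mul hw, fun _ => ?_,
        fun h' => by omega⟩
      rw [mul_assoc, mul_comm w, hw1, mul_one]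
    · exact ⟨0, isSigned_zero, fun h' => by omega, fun _ => rfl⟩
  choose r hr using hex
  refine ⟨r, hr, fun r' hr' => funext fun i => ?_⟩
  rcases le_or_gt ((i : ℕ) + 1) (P.natDegree - P.natTrailingDegree) with hi | hi
  · exact (hP (P.natDegree - i)).mul_right_cancel (hne i (by omega))
      (((hr' i).2.1 hi).trans ((hr i).2.1 hi).symm)
  · exact ((hr' i).2.2 hi).trans ((hr i).2.2 hi).symm

namespace IsRootSequence

variable {P : (Smax Γ)[X]} {r : Fin P.natDegree → Smax Γ}

/-- The recurrence also covers the indices past `n - m`, where both sides vanish; this spares later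
case distinctions. -/
theorem coeff_succ (hr : IsRootSequence P r) (i : Fin P.natDegree) :
    P.coeff (P.natDegree - (i + 1)) = -r i * P.coeff (P.natDegree - i) := by
  rcases le_or_gt ((i : ℕ) + 1) (P.natDegree - P.natTrailingDegree) with hi | hi
  · rw [neg_mul'', (hr i).2.1 hi, neg_neg'']
  · rw [(hr i).2.2 hi, neg_zero', zero_mul]
    exact coeff_eq_zero_of_lt_natTrailingDegree (by omega)

theorem abs_coeff_succ (hr : IsRootSequence P r) (i : Fin P.natDegree) :
    abs Γ (P.coeff (P.natDegree - (i + 1))) =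
      abs Γ (r i) * abs Γ (P.coeff (P.natDegree - i)) := by
  rw [hr.coeff_succ, map_mul, abs_neg]

/-- Cancelling nonzero coefficients identifies the first `n - m` moduli with the sorted tropical
factors; the remaining moduli are zero. -/
theorem antitone_abs (hr : IsRootSequence P r) (hP0 : P ≠ 0)
    (h : Tmax.IsFactored (absPoly P)) : Antitone fun i => abs Γ (r i) := by
  obtain ⟨c, hc, hcP⟩ := exists_antitone_of_isFactored h
  have key : ∀ i : Fin P.natDegree, (i : ℕ) + 1 ≤ P.natDegree - P.natTrailingDegree →
      abs Γ (r i) = c i := fun i hi =>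
    Tmax.mul_right_cancel_of_ne_zero
      (fun e => coeff_ne_zero_of_isFactored hP0 h (i := i) (by omega) (abs_eq_zero.1 e))
      ((hr.abs_coeff_succ i).symm.trans (hcP i))
  intro i j hij
  rcases le_or_gt ((j : ℕ) + 1) (P.natDegree - P.natTrailingDegree) with hj | hj
  · have hij' : (i : ℕ) ≤ j := hij
    change abs Γ (r j) ≤ abs Γ (r i)
    rw [key i (by omega), key j hj]
    exact hc hij
  · change abs Γ (r j) ≤ abs Γ (r i)
    rw [(hr j).2.2 hj, map_zero]
    exact Tmax.zero_le _

theorem isSigned_of_mem (hr : IsRootSequence P r) : ∀ x ∈ List.ofFn r, IsSigned x := by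
  intro x hx
  obtain ⟨i, rfl⟩ := List.mem_ofFn.1 hx
  exact (hr i).1

/-- Condition (a) settles the ties of moduli: equal terms absorb each other by idempotency, whereas
opposite nonzero ones would add up to a balanced element. -/
theorem pairwise_absorb (hr : IsRootSequence P r) (hanti : Antitone fun i => abs Γ (r i))
    (ha : ∀ i j, abs Γ (r i) = abs Γ (r j) → r i = r j) :
    ((List.ofFn r).map fun s => -s).Pairwise fun a b => a + b = a := by
  rw [List.pairwise_map, List.pairwise_ofFn]
  intro i j hij
  refine (hr i).1.neg.add_eq_left_of_le ?_ fun h => ?_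
  · simpa using hanti hij.le
  · rw [abs_neg, abs_neg] at h
    rw [ha j i h]

/-- In degree `n - t` both sides have the coefficient `P_n` times the product of the first `t` terms
`⊖r i`: on the left by the recurrence, on the right by absorption. The equality is one of formal
polynomials, as multiplicities require. -/
theorem eq_rootProd (hr : IsRootSequence P r) (hanti : Antitone fun i => abs Γ (r i))
    (ha : ∀ i j, abs Γ (r i) = abs Γ (r j) → r i = r j) :
    P = rootProd P.leadingCoeff (List.ofFn r) := by
  have hl := hr.pairwise_absorb hanti ha
  have key : ∀ t ≤ P.natDegree, P.coeff (P.natDegree - t) =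
      P.leadingCoeff * (((List.ofFn r).map fun s => -s).take t).prod := by
    intro t
    induction t with
    | zero => simp
    | succ t ih =>
      intro ht
      rw [hr.coeff_succ ⟨t, ht⟩]
      change -r ⟨t, ht⟩ * P.coeff (P.natDegree - t) = _
      rw [ih (by omega), List.take_add_one, List.getElem?_eq_getElem (by simpa using ht),
        Option.toList_some, List.prod_append, List.prod_singleton, List.getElem_map,
        List.getElem_ofFn]
      ring
  ext j
  rcases le_or_gt j P.natDegree with hj | hj
  · have := key (P.natDegree - j) (Nat.sub_le _ _)
    rw [Nat.sub_sub_self hj] at this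
    rw [coeff_rootProd _ hl (by simpa using hj), this, List.length_ofFn]
  · rw [coeff_eq_zero_of_natDegree_lt hj, coeff_rootProd_of_length_lt _ (by simpa using hj)]

/-- The monomial of degree `n - k` is dominant at `y` if the first `k` moduli are at least `|y|`
and the other ones are at most `|y|`. -/
theorem isDominant (hr : IsRootSequence P r) (hP0 : P ≠ 0) {y : Smax Γ} (hy : y ≠ 0) {k : ℕ}
    (hk : k ≤ P.natDegree) (h1 : ∀ i : Fin P.natDegree, (i : ℕ) < k → abs Γ y ≤ abs Γ (r i))
    (h2 : ∀ i : Fin P.natDegree, k ≤ i → abs Γ (r i) ≤ abs Γ y) :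
    IsDominant P y (P.natDegree - k) := by
  have hy0 : abs Γ y ≠ 0 := fun e => hy (abs_eq_zero.1 e)
  -- The moduli of the monomials, listed from the top degree down. By `hstep`, passing from index
  -- `i` to `i + 1` multiplies by `|r i| / |y|`, so `f` does not decrease up to `k` and does not
  -- increase afterwards.
  set f : ℕ → Tmax Γ := fun t => abs Γ (P.coeff (P.natDegree - t) * y ^ (P.natDegree - t)) with hf
  have hstep : ∀ i : Fin P.natDegree, f (i + 1) * abs Γ y = abs Γ (r i) * f i := by
    intro i
    have he : P.natDegree - i = P.natDegree - (i + 1) + 1 := by omega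
    simp only [hf, map_mul, hr.abs_coeff_succ, map_pow]
    rw [he, pow_succ]
    ring
  have hup : ∀ t ≤ k, f t ≤ f k := by
    intro t ht
    refine Nat.decreasingInduction (motive := fun t _ => f t ≤ f k) (fun t ht ih => ?_) le_rfl ht
    refine le_trans (Tmax.le_of_mul_le_mul_right_of_ne_zero hy0 ?_) ih
    rw [hstep ⟨t, by omega⟩, mul_comm]
    exact Tmax.mul_le_mul_right' (h1 ⟨t, by omega⟩ ht) _
  have hdown : ∀ t, k ≤ t → t ≤ P.natDegree → f t ≤ f k := by
    intro t ht
    induction t, ht using Nat.le_induction with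
    | base => exact fun _ => le_rfl
    | succ t ht ih =>
      intro htn
      refine le_trans (Tmax.le_of_mul_le_mul_right_of_ne_zero hy0 ?_) (ih (by omega))
      rw [hstep ⟨t, htn⟩, mul_comm (f t)]
      exact Tmax.mul_le_mul_right' (h2 ⟨t, htn⟩ ht) _
  obtain ⟨m, hm⟩ := exists_isDominant hP0 y
  have hmn : m ≤ P.natDegree := le_natDegree_of_ne_zero (hm.coeff_ne_zero hP0 hy)
  refine le_antisymm (abs_coeff_mul_pow_le P y _) ?_
  have : f (P.natDegree - m) ≤ f k := by
    rcases le_total (P.natDegree - m) k with h | h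
    · exact hup _ h
    · exact hdown _ h (Nat.sub_le _ _)
  simp only [hf] at this
  rw [Nat.sub_sub_self hmn] at this
  rwa [← hm]

/-- Dominant monomials at `y` of degrees `i < j` force the moduli of the roots in between to be
equal to `|y|`. -/
theorem abs_eq_of_isDominant (hr : IsRootSequence P r) (hP0 : P ≠ 0)
    (hanti : Antitone fun i => abs Γ (r i)) {y : Smax Γ} (hy : y ≠ 0) {i j : ℕ}
    (hi : IsDominant P y i) (hj : IsDominant P y j) (t : Fin P.natDegree)
    (h1 : P.natDegree - j ≤ t) (h2 : (t : ℕ) < P.natDegree - i) : abs Γ (r t) = abs Γ y := by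
  have hpow : ∀ k, abs Γ y ^ k ≠ 0 := fun k => pow_ne_zero k fun e => hy (abs_eq_zero.1 e)
  have hjn : j ≤ P.natDegree := le_natDegree_of_ne_zero (hj.coeff_ne_zero hP0 hy)
  have hij : i < j := by omega
  apply le_antisymm
  -- Degree `j` dominates degree `j - 1`, which bounds the modulus at index `n - j` by `|y|`; the
  -- moduli do not increase from there to `t`.
  · refine le_trans (hanti (show (⟨P.natDegree - j, by omega⟩ : Fin P.natDegree) ≤ t from h1)) ?_
    have hc := hr.abs_coeff_succ ⟨P.natDegree - j, by omega⟩
    simp only [Nat.sub_sub_self hjn] at hc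
    have hle := abs_coeff_mul_pow_le P y (P.natDegree - (P.natDegree - j + 1))
    obtain ⟨s, rfl⟩ : ∃ s, j = s + 1 := ⟨j - 1, by omega⟩
    rw [← hj, map_mul, hc, map_mul, map_pow, map_pow,
      show P.natDegree - (P.natDegree - (s + 1) + 1) = s by omega, pow_succ] at hle
    refine Tmax.le_of_mul_le_mul_right_of_ne_zero
      (mul_ne_zero (fun e => hj.coeff_ne_zero hP0 hy (abs_eq_zero.1 e)) (hpow s)) ?_
    convert hle using 1 <;> ring
  -- Degree `i` dominates degree `i + 1`, so the modulus at index `n - (i + 1)` is at least `|y|`,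
  -- and the one at `t` is no smaller.
  · refine le_trans ?_ (hanti (show t ≤ (⟨P.natDegree - (i + 1), by omega⟩ : Fin P.natDegree) from
      Fin.le_def.2 (by simp only []; omega)))
    have hc := hr.abs_coeff_succ ⟨P.natDegree - (i + 1), by omega⟩
    simp only [Nat.sub_sub_self (show i + 1 ≤ P.natDegree by omega),
      show P.natDegree - (P.natDegree - (i + 1) + 1) = i by omega] at hc
    have hle := abs_coeff_mul_pow_le P y (i + 1)
    rw [← hi, map_mul, map_mul, hc, map_pow, map_pow, pow_succ] at hle
    have hne : abs Γ (P.coeff (i + 1)) ≠ 0 := by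
      intro e
      rw [e, mul_zero, abs_eq_zero] at hc
      exact hi.coeff_ne_zero hP0 hy hc
    refine Tmax.le_of_mul_le_mul_right_of_ne_zero (mul_ne_zero hne (hpow i)) ?_
    convert hle using 1 <;> ring

/-- For the root `0`, the lower degree bounds `k` and the last `m` terms of the sequence are zero.
For a nonzero root, all indices between dominant degrees have its modulus, hence its value by (a).
-/
theorem le_natCard_of_multGE (hr : IsRootSequence P r) (hP0 : P ≠ 0) (hP : IsSignedPoly P)
    (hanti : Antitone fun i => abs Γ (r i))
    (ha : ∀ i j, abs Γ (r i) = abs Γ (r j) → r i = r j) {i₀ : Fin P.natDegree} {k : ℕ}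
    (h : MultGE (r i₀) P k) : k ≤ Nat.card {i // r i = r i₀} := by
  by_cases hx : r i₀ = 0
  · rw [hx] at h ⊢
    have hkm : k ≤ P.natTrailingDegree :=
      le_natTrailingDegree hP0 fun j hj => h.coeff_eq_zero hP hj
    have hmn := P.natTrailingDegree_le_natDegree
    have := le_natCard_of_forall_eq r 0 (a := P.natDegree - P.natTrailingDegree) le_rfl
      fun i hi _ => (hr i).2.2 (by omega)
    omega
  · obtain ⟨i, j, hi, hj, hij⟩ := h.exists_isDominant (hr i₀).1 hx hP hP0
    have hjn : j ≤ P.natDegree := le_natDegree_of_ne_zero (hj.coeff_ne_zero hP0 hx)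
    have := le_natCard_of_forall_eq r (r i₀) (a := P.natDegree - j) (b := P.natDegree - i)
      (Nat.sub_le _ _)
      fun t h1 h2 => ha _ _ (hr.abs_eq_of_isDominant hP0 hanti hx hi hj t h1 h2)
    omega

theorem isRoot_iff (hr : IsRootSequence P r) (hP0 : P ≠ 0) (hP : IsSignedPoly P)
    (hanti : Antitone fun i => abs Γ (r i))
    (ha : ∀ i j, abs Γ (r i) = abs Γ (r j) → r i = r j) {x : Smax Γ} :
    IsRoot P x ↔ ∃ i, r i = x := by
  have h := isRoot_rootProd_iff (hP P.natDegree) (leadingCoeff_ne_zero.2 hP0)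
    hr.isSigned_of_mem (y := x)
  change IsRoot (rootProd P.leadingCoeff (List.ofFn r)) x ↔ _ at h
  rwa [← hr.eq_rootProd hanti ha, List.mem_ofFn] at h

theorem count_ofFn [DecidableEq (Smax Γ)] (x : Smax Γ) :
    (List.ofFn r).count x = Nat.card {i // r i = x} := by
  rw [← Multiset.coe_count, ← Fin.univ_val_map, Multiset.count_map, Nat.card_eq_fintype_card,
    Fintype.card_subtype]
  simp only [eq_comm (a := x)]
  rfl

theorem mult_eq (hr : IsRootSequence P r) (hP0 : P ≠ 0) (hP : IsSignedPoly P)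
    (hanti : Antitone fun i => abs Γ (r i))
    (ha : ∀ i j, abs Γ (r i) = abs Γ (r j) → r i = r j) {x : Smax Γ} (hx : IsRoot P x) :
    mult x P = (Nat.card {i // r i = x} : ℕ∞) := by
  classical
  obtain ⟨i₀, rfl⟩ := (hr.isRoot_iff hP0 hP hanti ha).1 hx
  apply le_antisymm
  · exact iSup₂_le fun k hk => by exact_mod_cast hr.le_natCard_of_multGE hP0 hP hanti ha hk
  · refine MultGE.le_mult ?_
    have := multGE_rootProd ⟨hP P.natDegree, leadingCoeff_ne_zero.2 hP0⟩ (r i₀) _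
      hr.isSigned_of_mem (hr.pairwise_absorb hanti ha) le_rfl
    change MultGE (r i₀) (rootProd P.leadingCoeff (List.ofFn r)) _ at this
    rwa [count_ofFn, ← hr.eq_rootProd hanti ha] at this

theorem isFactorization (hr : IsRootSequence P r) (hanti : Antitone fun i => abs Γ (r i))
    (ha : ∀ i j, abs Γ (r i) = abs Γ (r j) → r i = r j) :
    IsFactorization P (Finset.univ.val.map r) := by
  rw [Fin.univ_val_map]
  refine ⟨hr.isSigned_of_mem, by simp, fun y => ?_⟩
  conv_lhs => rw [hr.eq_rootProd hanti ha]
  exact eval_rootProd _ _ _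

end IsRootSequence

/-! ### Uniqueness of the factorization -/

/-- Two factorizations of the same polynomial function coincide if, in one of them, factors of the
same modulus are equal. -/
theorem IsFactorization.unique [Nontrivial Γ]
    (hdiv : ∀ n : ℕ, 0 < n → ∀ a : Γ, ∃ b : Γ, n • b = a) {P : (Smax Γ)[X]} (hP0 : P ≠ 0)
    (hP : IsSignedPoly P) {s t : Multiset (Smax Γ)} (hs : IsFactorization P s)
    (ht : IsFactorization P t)
    (hinj : ∀ a ∈ t, ∀ b ∈ t, abs Γ a = abs Γ b → a = b) : s = t := by
  classical
  have hlc : P.leadingCoeff ≠ 0 := leadingCoeff_ne_zero.2 hP0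
  -- The elements of any factorization are the signed points with balanced value, a description that
  -- involves only `P`.
  have hmem : ∀ x, x ∈ s ↔ x ∈ t := by
    have key : ∀ {u : Multiset (Smax Γ)}, IsFactorization P u →
        ∀ x, x ∈ u ↔ IsSigned x ∧ IsBalanced (P.eval x) := by
      intro u hu x
      constructor
      · intro hx
        refine ⟨hu.1 x hx, ?_⟩
        rw [hu.2.2 x]
        exact (isBalanced_mul_prod_iff (hP _) hlc hu.1 (hu.1 x hx)).2 hx
      · rintro ⟨hx, hb⟩
        rw [hu.2.2 x] at hb
        exact (isBalanced_mul_prod_iff (hP _) hlc hu.1 hx).1 hb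
    exact fun x => (key hs x).trans (key ht x).symm
  -- Moduli of the values at positive points give tropical products of linear forms, which determine
  -- their factors.
  have habs : s.map (abs Γ) = t.map (abs Γ) := by
    refine Tmax.multiset_eq_of_prod_map_add_eq hdiv P.natDegree _ _ (by simp [hs.2.1])
      (by simp [ht.2.1]) fun y _ => ?_
    have h := congrArg (abs Γ) ((hs.2.2 (pos y)).symm.trans (ht.2.2 (pos y)))
    rw [map_mul, map_mul, mul_comm, mul_comm (abs Γ P.leadingCoeff)] at h
    have h' := Tmax.mul_right_cancel_of_ne_zero (fun e => hlc (abs_eq_zero.1 e)) h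
    simpa [map_multiset_prod, Multiset.map_map] using h'
  -- As the modulus is injective on the elements of `t`, counting a modulus amounts to counting the
  -- element that has it.
  have hcount : ∀ {u : Multiset (Smax Γ)}, (∀ a ∈ u, a ∈ t) → ∀ x ∈ u,
      (u.map (abs Γ)).count (abs Γ x) = u.count x := by
    intro u hu x hx
    rw [Multiset.count_map, Multiset.count, Multiset.countP_eq_card_filter]
    congr 1
    exact Multiset.filter_congr fun a ha =>
      ⟨fun e => hinj _ (hu x hx) _ (hu a ha) e, fun e => congrArg (abs Γ) e⟩
  ext x
  by_cases hx : x ∈ s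
  · rw [← hcount (fun a ha => (hmem a).1 ha) x hx, habs,
      hcount (fun a ha => ha) x ((hmem x).1 hx)]
  · rw [Multiset.count_eq_zero_of_notMem hx,
      Multiset.count_eq_zero_of_notMem fun h => hx ((hmem x).2 h)]

/-! ### Opposite dominant monomials and the equivalence of (a) and (b) -/

theorem eval_add_coeff_mul_pow (P : (Smax Γ)[X]) (y : Smax Γ) (k : ℕ) :
    P.coeff k * y ^ k + P.eval y = P.eval y := by
  by_cases hk : k ∈ P.support
  · rw [eval_eq_sum, sum_def, ← Finset.add_sum_erase _ (fun k => P.coeff k * y ^ k) hk,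
      ← add_assoc, add_self]
  · rw [notMem_support_iff.1 hk, zero_mul, zero_add]

/-- By idempotency the two opposite monomials can be added once more to the value. Their sum is
balanced and of maximal modulus, so it absorbs the whole value. -/
theorem isBalanced_eval_of_isDominant {P : (Smax Γ)[X]} {y : Smax Γ} {i j : ℕ}
    (hi : IsDominant P y i) (hij : P.coeff j * y ^ j = -(P.coeff i * y ^ i)) :
    IsBalanced (P.eval y) := by
  have hb : IsBalanced (P.coeff i * y ^ i + P.coeff j * y ^ j) :=
    hij ▸ isBalanced_add_neg_self _
  have h : P.coeff i * y ^ i + P.coeff j * y ^ j + P.eval y = P.eval y := by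
    rw [add_assoc, eval_add_coeff_mul_pow, eval_add_coeff_mul_pow]
  rw [hb.add_eq_left] at h
  · rwa [← h]
  · rw [map_add, ← hi]
    exact Tmax.le_add_left _ _

namespace IsRootSequence

variable {P : (Smax Γ)[X]} {r : Fin P.natDegree → Smax Γ}

/-- Here `r (k+1) = ⊖r k`, so two steps of the recurrence give `P_{n-k-2} = ⊖(r k)² P_{n-k}`. At
modulus `|r k|` the monomials of degrees `n - k` and `n - k - 2` are thus opposite, and they are
dominant. -/
theorem isRoot_of_ne (hr : IsRootSequence P r) (hP0 : P ≠ 0)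
    (hanti : Antitone fun i => abs Γ (r i)) {k : ℕ} (hk : k + 1 < P.natDegree)
    (hne : r ⟨k, by omega⟩ ≠ r ⟨k + 1, hk⟩)
    (habs : abs Γ (r ⟨k, by omega⟩) = abs Γ (r ⟨k + 1, hk⟩)) {y : Smax Γ} (hy : IsSigned y)
    (hyr : abs Γ y = abs Γ (r ⟨k, by omega⟩)) :
    IsRoot P y ∧ IsDominant P y (P.natDegree - k) ∧
      IsDominant P y (P.natDegree - (k + 1)) := by
  have hneg : r ⟨k + 1, hk⟩ = -r ⟨k, by omega⟩ :=
    ((hr _).1.eq_or_eq_neg (hr _).1 habs.symm).resolve_left hne.symm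
  have hy0 : y ≠ 0 := by
    rintro rfl
    rw [map_zero] at hyr
    exact hne ((abs_eq_zero.1 hyr.symm).trans (abs_eq_zero.1 (hyr.trans habs).symm).symm)
  have h1 : ∀ i : Fin P.natDegree, (i : ℕ) < k + 2 → abs Γ y ≤ abs Γ (r i) := fun i hi => by
    rw [hyr, habs]
    exact hanti (Fin.le_def.2 (by simp only []; omega))
  have h2 : ∀ i : Fin P.natDegree, k ≤ i → abs Γ (r i) ≤ abs Γ y := fun i hi => by
    rw [hyr]
    exact hanti (Fin.le_def.2 hi)
  have hdk := hr.isDominant hP0 hy0 (k := k) (by omega) (fun i hi => h1 i (by omega)) h2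
  refine ⟨⟨hy, balances_zero_iff.2 (isBalanced_eval_of_isDominant hdk
    (j := P.natDegree - (k + 2)) ?_)⟩, hdk, hr.isDominant hP0 hy0 hk.le
    (fun i hi => h1 i (by omega)) (fun i hi => h2 i (by omega))⟩
  -- Only the square of `y` enters, so its sign is immaterial; this is why `c` and `⊖c` are both
  -- roots.
  have hyy : y * y = r ⟨k, by omega⟩ * r ⟨k, by omega⟩ := by
    rcases hy.eq_or_eq_neg (hr _).1 hyr with h | h
    · rw [h]
    · rw [h, neg_mul'', mul_neg'', neg_neg'']
  have hc1 := hr.coeff_succ ⟨k, by omega⟩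
  have hc2 := hr.coeff_succ ⟨k + 1, hk⟩
  simp only [add_assoc, Nat.reduceAdd] at hc1 hc2
  rw [hc2, hc1, hneg, neg_neg'', show P.natDegree - k = P.natDegree - (k + 2) + 2 by omega, pow_add,
    pow_two, hyy, neg_mul'', mul_neg'', neg_mul'']
  congr 1
  ring

theorem exists_ne_succ {n : ℕ} {α : Type*} {f : Fin n → α} {i j : Fin n} (hij : i ≤ j)
    (h : f i ≠ f j) :
    ∃ (k : ℕ) (hk : k + 1 < n), (i : ℕ) ≤ k ∧ k + 1 ≤ j ∧ f ⟨k, by omega⟩ ≠ f ⟨k + 1, hk⟩ := by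
  by_contra! hc
  have key : ∀ t, (i : ℕ) ≤ t → ∀ ht : t ≤ j, f ⟨t, by omega⟩ = f i := by
    intro t hit
    induction t, hit using Nat.le_induction with
    | base => exact fun _ => rfl
    | succ t hit ih =>
      intro ht
      rw [← hc t (by omega) hit ht]
      exact ih (by omega)
  exact h (key j hij le_rfl).symm

theorem forall_abs_eq_iff (hr : IsRootSequence P r) (hP0 : P ≠ 0) (hP : IsSignedPoly P)
    (hanti : Antitone fun i => abs Γ (r i)) :
    (∀ i j, abs Γ (r i) = abs Γ (r j) → r i = r j) ↔
      ∀ c : Tmax Γ, c ≠ 0 → Tmax.IsCorner (absPoly P) c →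
        ¬ (IsRoot P (pos c) ∧ IsRoot P (-pos c)) := by
  constructor
  · rintro ha c hc - ⟨h1, h2⟩
    rw [hr.isRoot_iff hP0 hP hanti ha] at h1 h2
    obtain ⟨i, hi⟩ := h1
    obtain ⟨j, hj⟩ := h2
    have := ha i j (by rw [hi, hj, abs_neg])
    rw [hi, hj, eq_neg_self_iff (isSigned_pos c)] at this
    exact hc (by simpa using congrArg (abs Γ) this)
  · intro hb
    by_contra! hc
    obtain ⟨i, j, hij, habs, hne⟩ : ∃ i j, i ≤ j ∧ abs Γ (r i) = abs Γ (r j) ∧ r i ≠ r j := by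
      obtain ⟨i, j, h1, h2⟩ := hc
      rcases le_total i j with h | h
      · exact ⟨i, j, h, h1, h2⟩
      · exact ⟨j, i, h, h1.symm, h2.symm⟩
    obtain ⟨k, hk, hik, hkj, hk'⟩ := exists_ne_succ hij hne
    -- Monotonicity makes the modulus constant between `i` and `j`, so the consecutive distinct
    -- terms found there share it.
    have hconst : ∀ t : Fin P.natDegree, i ≤ t → t ≤ j → abs Γ (r t) = abs Γ (r i) :=
      fun t h1 h2 => le_antisymm (hanti h1) (habs ▸ hanti h2)
    have hak : abs Γ (r ⟨k, by omega⟩) = abs Γ (r ⟨k + 1, hk⟩) :=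
      (hconst _ (Fin.le_def.2 hik) (Fin.le_def.2 (by simp only []; omega))).trans
        (hconst _ (Fin.le_def.2 (by simp only []; omega)) (Fin.le_def.2 hkj)).symm
    set c := abs Γ (r ⟨k, by omega⟩)
    have hc0 : c ≠ 0 := fun e =>
      hk' ((abs_eq_zero.1 e).trans (abs_eq_zero.1 (hak.symm.trans e)).symm)
    have hpos0 : (pos c : Smax Γ) ≠ 0 := fun e => hc0 (by simpa using congrArg (abs Γ) e)
    obtain ⟨hroot, hd1, hd2⟩ := hr.isRoot_of_ne hP0 hanti hk hk' hak (isSigned_pos c)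
      (abs_pos c)
    obtain ⟨hroot', -, -⟩ := hr.isRoot_of_ne hP0 hanti hk hk' hak (isSigned_pos c).neg
      ((abs_neg _).trans (abs_pos c))
    have hsupp : ∀ {m}, IsDominant P (pos c) m → m ∈ (absPoly P).support ∧
        (absPoly P).coeff m * c ^ m = (absPoly P).eval c := by
      intro m hm
      constructor
      · rw [mem_support_iff, absPoly, coeff_map, Ne, abs_eq_zero]
        exact hm.coeff_ne_zero hP0 hpos0
      · rw [IsDominant, abs_eval, abs_pos, map_mul, map_pow, abs_pos] at hm
        rw [← hm, absPoly, coeff_map]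
    -- The monomials of degrees `n - k` and `n - (k + 1)` are both dominant and show that `c` is a
    -- corner.
    exact hb c hc0 (Or.inl ⟨hc0, _, (hsupp hd1).1, _, (hsupp hd2).1, by omega, (hsupp hd1).2,
      (hsupp hd2).2⟩) ⟨hroot, hroot'⟩

end IsRootSequence

end Smax

theorem mainTheorem7 {Γ : Type*} [AddCommGroup Γ] [LinearOrder Γ] [IsOrderedAddMonoid Γ]
    (hdiv : ∀ n : ℕ, 0 < n → ∀ a : Γ, ∃ b : Γ, n • b = a)
    (P : (Smax Γ)[X]) (hP0 : P ≠ 0) (hP : Smax.IsSignedPoly P)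
    (hfac : Tmax.IsFactored (Smax.absPoly P)) :
    (∃! r : Fin P.natDegree → Smax Γ, Smax.IsRootSequence P r) ∧
    ∀ r : Fin P.natDegree → Smax Γ, Smax.IsRootSequence P r →
      ((∀ i j, Smax.abs Γ (r i) = Smax.abs Γ (r j) → r i = r j) ↔
        ∀ c : Tmax Γ, c ≠ 0 → Tmax.IsCorner (Smax.absPoly P) c →
          ¬ (Smax.IsRoot P (Smax.pos c) ∧ Smax.IsRoot P (-Smax.pos c))) ∧
      ((∀ i j, Smax.abs Γ (r i) = Smax.abs Γ (r j) → r i = r j) →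
        Smax.IsFactorization P (Finset.univ.val.map r) ∧
        (Nontrivial Γ → ∀ s : Multiset (Smax Γ), Smax.IsFactorization P s →
          s = Finset.univ.val.map r) ∧
        ∀ x : Smax Γ, Smax.IsRoot P x →
          Smax.mult x P = (Nat.card {i // r i = x} : ℕ∞)) := by
  refine ⟨Smax.existsUnique_isRootSequence hP0 hP hfac, fun r hr => ?_⟩
  have hanti := hr.antitone_abs hP0 hfac
  refine ⟨hr.forall_abs_eq_iff hP0 hP hanti, fun ha => ?_⟩
  have hfact := hr.isFactorization hanti ha
  refine ⟨hfact, fun _ s hs => hs.unique hdiv hP0 hP hfact ?_,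
    fun x hx => hr.mult_eq hP0 hP hanti ha hx⟩
  intro a ha' b hb'
  obtain ⟨i, -, rfl⟩ := Multiset.mem_map.1 ha'
  obtain ⟨j, -, rfl⟩ := Multiset.mem_map.1 hb'
  exact ha i j
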